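/- For an odd positive integer $L$ and $\lambda\ge 0$ let $\Delta_L(\lambda)$ be the solution $\Delta$ (with $\Delta+L/2\neq 0$) of the light-cone Bethe equation of the highest state in the $\mathfrak{su}(1|1)$ sector, $$\Delta=\frac L2+\sum_{n=-(L-1)/2}^{(L-1)/2}\sqrt{1+\frac{\lambda}{\pi^2}\sin^2\frac{p_n}{2}},\qquad p_n=\frac{4\pi n}{\Delta+L/2},$$ and let $u=u(\lambda)\ne0$ be the solution of $$u=1+\frac u\pi\,E\Big(\frac\pi u,-\frac{\lambda}{\pi^2}\Big),\qquad E(z,m)=\int_0^z\sqrt{1-m\sin^2\theta}\,d\theta .$$ Both solutions exist and are unique. Moreover (with $L\to\infty$ always through odd integers): 1. For every fixed $\lambda\ge0$, $\Delta_L(\lambda)$ has a Poincaré asymptotic expansion to all orders in $1/L$, $$\Delta_L(\lambda)\sim L\Big(u-\frac12\Big)+z_1+\frac{z_2}{L}+\frac{z_3}{L^2}+\cdots\qquad(L\to\infty),$$ with $$z_1=0,\qquad z_2=-\frac{\lambda}{12\pi}\,\sin\frac{2\pi}{u}\;\frac{1}{S(1+S)},\qquad S=\sqrt{1+\frac{\lambda}{\pi^2}\sin^2\frac{\pi}{u}}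 .$$ In particular $\lim_{L\to\infty}\Delta_L(\lambda)/L=u(\lambda)-\frac12$. 2. As $\lambda\to\infty$, $$u-\frac12=\frac{\lambda^{1/4}}{\sqrt2}+\frac{\lambda^{-1/4}}{48\sqrt2}\big(3\log\lambda+18\log2+18-4\pi^2\big)+O(\lambda^{-1/2}\log\lambda),\qquad z_2=-\frac{\lambda^{1/4}}{6\sqrt2}+O(\lambda^{-1/4}\log\lambda).$$ 3. The limits $L\to\infty$ and $\lambda\to\infty$ commute at leading order only. For every fixed odd $L\ge3$, as $\lambda\to\infty$, $$\frac{\Delta_L(\lambda)}{L}=c_L\lambda^{1/4}+\frac1{2L}+e_L\lambda^{-1/4}+O(\lambda^{-1/2}),\qquad c_L=\frac1{\sqrt2}\Big(1-\frac1{L^2}\Big)^{1/2},$$ $$e_L=\frac{1}{4\sqrt2}\Big(1+\frac1L\Big)^2\Big(1-\frac1{L^2}\Big)^{-1/2}-\frac{\pi^2}{12\sqrt2}\Big(1-\frac1{L^2}\Big)^{1/2}+\frac1{4\sqrt2}\Big(1-\frac1{L^2}\Big)^{1/2}\sum_{k=1}^{(L-1)/2}\frac1k .$$ Consequently: (a)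 both iterated limits of $\Delta_L(\lambda)/(L\lambda^{1/4})$ exist and equal $1/\sqrt2$ (the limit $\lambda\to\infty$ at fixed $L$ being taken for odd $L\ge3$, here and below); (b) $\lim_{\lambda\to\infty}\lim_{L\to\infty}\big(\Delta_L(\lambda)/L-\lambda^{1/4}/\sqrt2\big)=0$, whereas for every odd $L\ge3$ the same function tends to $-\infty$ as $\lambda\to\infty$; (c) the coefficients of $L^{-1}\lambda^0$ differ: $\lim_{\lambda\to\infty}\lim_{L\to\infty}L\big(\Delta_L(\lambda)/L-(u-\frac12)\big)=0$, but $\lim_{L\to\infty}\lim_{\lambda\to\infty}L\big(\Delta_L(\lambda)/L-c_L\lambda^{1/4}\big)=\frac12$; (d) the coefficients of $L^{-2}\lambda^{1/4}$ differ: $\lim_{\lambda\to\infty}\lim_{L\to\infty}L^2\lambda^{-1/4}\big(\Delta_L(\lambda)/L-(u-\frac12)\big)=-\frac1{6\sqrt2}$, but $\lim_{L\to\infty}\lim_{\lambda\to\infty}L^2\big(\Delta_L(\lambda)/(L\lambda^{1/4})-\frac1{\sqrt2}\big)=-\frac1{2\sqrt2}$; (e) $e_L$ has no finite limit: $e_L/\log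 L\to\frac1{4\sqrt2}$ as $L\to\infty$. -/

import Mathlib

open Real Filter Topology Asymptotics

noncomputable section

/-- The filter "`L → ∞` through the odd positive integers". -/
def oddAtTop : Filter ℕ := atTop ⊓ 𝓟 {L : ℕ | Odd L}

/-- The one-particle light-cone energy `√(1 + (λ/π²) sin²(p/2))`. -/
def dispersion (lam p : ℝ) : ℝ := √(1 + lam / π ^ 2 * sin (p / 2) ^ 2)

/-- The Bethe momentum with mode number `n`, i.e. the solution `p = 4πn / (Δ + L/2)` of
`exp (i p P₊ / 2) = 1` with `P₊ = Δ + J`, `J = L/2`. -/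
def betheMomentum (L : ℕ) (Del : ℝ) (n : ℤ) : ℝ := 4 * π * n / (Del + L / 2)

/-- `Del` solves the light-cone Bethe equation of the highest `su(1|1)` state with `L` (odd)
momenta at coupling `lam`:
`Δ = L/2 + ∑ √(1 + (λ/π²) sin²(p_n/2))`, `n = -(L-1)/2, …, (L-1)/2`. -/
def IsHighestEnergy (L : ℕ) (lam Del : ℝ) : Prop :=
  Del + L / 2 ≠ 0 ∧
    Del = L / 2 + ∑ n ∈ Finset.Icc (-(((L : ℤ) - 1) / 2)) (((L : ℤ) - 1) / 2),
      dispersion lam (betheMomentum L Del n)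

/-- The incomplete elliptic integral of the second kind `E(z, m)`. -/
def ellipticE (z m : ℝ) : ℝ := ∫ θ in (0 : ℝ)..z, √(1 - m * sin θ ^ 2)

/-- The equation `u = 1 + (u/π) E(π/u, -λ/π²)`. -/
def IsLeadingSolution (lam u : ℝ) : Prop :=
  u ≠ 0 ∧ u = 1 + u / π * ellipticE (π / u) (-lam / π ^ 2)

/-- The coefficient `z₂` as a function of `λ` and `u`. -/
def zTwo (lam u : ℝ) : ℝ :=
  -(lam / (12 * π)) * sin (2 * π / u) *
    (1 / (√(1 + lam / π ^ 2 * sin (π / u) ^ 2) *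
      (1 + √(1 + lam / π ^ 2 * sin (π / u) ^ 2))))

/-- `D L` has the asymptotic (Poincaré) expansion `L a₀ + a₁ + a₂ / L + a₃ / L² + ⋯` as `L → ∞`
through odd integers. -/
def HasInvLExpansion (D : ℕ → ℝ) (a : ℕ → ℝ) : Prop :=
  ∀ N : ℕ, (fun L : ℕ => D L - L * ∑ n ∈ Finset.range (N + 1), a n / (L : ℝ) ^ n)
    =O[oddAtTop] (fun L : ℕ => 1 / (L : ℝ) ^ N)

/-- The coefficient of `λ^{1/4}` in `Δ_L / L` at fixed `L`. -/
def cCoeff (L : ℕ) : ℝ := 1 / √2 * √(1 - 1 / (L : ℝ) ^ 2)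

/-- The coefficient of `λ^{-1/4}` in `Δ_L / L` at fixed `L`. -/
def eCoeff (L : ℕ) : ℝ :=
  1 / (4 * √2) * (1 + 1 / (L : ℝ)) ^ 2 / √(1 - 1 / (L : ℝ) ^ 2)
    - π ^ 2 / (12 * √2) * √(1 - 1 / (L : ℝ) ^ 2)
    + 1 / (4 * √2) * √(1 - 1 / (L : ℝ) ^ 2) * ∑ k ∈ Finset.Icc 1 ((L - 1) / 2), 1 / (k : ℝ)

/-- Iterated limit, `L → ∞` (odd) first at every fixed `λ > 0`, then `λ → ∞`. -/
def LimLThenLam (F : ℕ → ℝ → ℝ) (c : ℝ) : Prop :=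
  ∃ g : ℝ → ℝ, (∀ lam : ℝ, 0 < lam → Tendsto (fun L => F L lam) oddAtTop (𝓝 (g lam))) ∧
    Tendsto g atTop (𝓝 c)

/-- Iterated limit, `λ → ∞` first at every fixed odd `L ≥ 3`, then `L → ∞` (odd). -/
def LimLamThenL (F : ℕ → ℝ → ℝ) (c : ℝ) : Prop :=
  ∃ g : ℕ → ℝ, (∀ L : ℕ, Odd L → 3 ≤ L → Tendsto (fun lam => F L lam) atTop (𝓝 (g L))) ∧
    Tendsto g oddAtTop (𝓝 c)

end

open scoped ContDiff

/-! Write `ω` for `angleEnergy lam` and put `x = Δ + L/2`, `v = x/L`. The half momenta `2πn/x` are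
the centres of `L` cells of width `s = 2π/(Lv)` that fill `[-π/v, π/v]` exactly. The Bethe equation
therefore says that `v - 1` is the midpoint-rule value of the average of `ω` over this interval, and
the equation for `u` is the same with the exact average.

Existence and uniqueness: since `ω ≥ 1`, solutions can only lie in `x ≥ 2L`, `u ≥ 2`. There the half
momenta stay in `[-π/2, π/2]`, where `ω` increases with the modulus, so the right-hand sides are
continuous, bounded and antitone, and have exactly one fixed point.

Fixed coupling: the midpoint sum equals a smooth function of the end point and the step up to any
power of the step (`exists_smooth_midpointSum_approx`). Thus `v` solves a smooth equation `f(1/L, v)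
= 0` up to any power of `1/L`. At `1/L = 0` this is `leadingDefect lam v = 0`, whose derivative `(1
+ S)/u` at `u` is positive, so the implicit function theorem and Taylor's formula give the
expansion. The first midpoint correction, divided by this derivative, is `zTwo`; there is no term of
first order, because cells centred at the nodes leave no error of order `s`.

Strong coupling: with `λ = μ⁴` the unknown `X` (`u` or `x`) is of size `μ`, the half momenta are
small, and `ω` is `√(1 + (qt)²)` minus a cubic term, with `q = μ²/X`. Integrating over `t`, or
summing over modes, and multiplying by `X` gives in both cases `X² - cX = Kμ² + αρ + h(ρ) + O(1/μ)`
with `ρ = (X/μ)²`, solved once and for all in `isBigO_sub_quadratic_expansion`.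

The two orders of limits differ through the data of this quadratic. For `u` one has `c = 1`, `K =
1/2`, and `α` contains `log μ` coming from `arsinh`. At fixed `L` the zero mode stays at energy 1,
so `c = L + 1`; moreover `K = (L² - 1)/2`, and the logarithm is replaced by a harmonic number, which
is what makes `eCoeff` grow like `log L`. -/

/-! ### Existence and uniqueness of both solutions -/

/-- A bounded antitone continuous function on `[c, ∞)` with values in `[c, ∞)` has exactly one
fixed point there. -/
theorem existsUnique_fixedPoint_of_antitoneOn {f : ℝ → ℝ} {c M : ℝ}
    (hcont : ContinuousOn f (Set.Ici c)) (hanti : AntitoneOn f (Set.Ici c))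
    (hlo : ∀ x ∈ Set.Ici c, c ≤ f x) (hhi : ∀ x ∈ Set.Ici c, f x ≤ M) :
    ∃ x, c ≤ x ∧ x = f x ∧ ∀ y, c ≤ y → y = f y → y = x := by
  have hcM : c ≤ M := (hlo c Set.self_mem_Ici).trans (hhi c Set.self_mem_Ici)
  have hg : ContinuousOn (fun x => x - f x) (Set.Icc c M) :=
    (continuousOn_id.sub hcont).mono Set.Icc_subset_Ici_self
  obtain ⟨x, hx, hxe⟩ : (0 : ℝ) ∈ (fun x => x - f x) '' Set.Icc c M := by
    apply intermediate_value_Icc hcM hg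
    exact ⟨by linarith [hlo c Set.self_mem_Ici], by linarith [hhi M hcM]⟩
  have hxf : x = f x := by
    have : x - f x = 0 := hxe
    linarith
  refine ⟨x, hx.1, hxf, fun y hy hyf => ?_⟩
  rcases le_total x y with h | h
  · have := hanti hx.1 hy h
    linarith
  · have := hanti hy hx.1 h
    linarith

/-- The one-particle energy as a function of the half momentum. -/
noncomputable def angleEnergy (lam w : ℝ) : ℝ := √(1 + lam / π ^ 2 * sin w ^ 2)

theorem dispersion_eq_angleEnergy (lam p : ℝ) : dispersion lam p = angleEnergy lam (p / 2) := rfl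

theorem angleEnergy_radicand_pos {lam : ℝ} (hlam : 0 ≤ lam) (w : ℝ) :
    0 < 1 + lam / π ^ 2 * sin w ^ 2 := by positivity

theorem one_le_angleEnergy {lam : ℝ} (hlam : 0 ≤ lam) (w : ℝ) : 1 ≤ angleEnergy lam w := by
  rw [angleEnergy, Real.one_le_sqrt]
  have : 0 ≤ lam / π ^ 2 * sin w ^ 2 := by positivity
  linarith

theorem angleEnergy_le {lam : ℝ} (hlam : 0 ≤ lam) (w : ℝ) :
    angleEnergy lam w ≤ √(1 + lam / π ^ 2) := by
  apply Real.sqrt_le_sqrt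
  have : lam / π ^ 2 * sin w ^ 2 ≤ lam / π ^ 2 * 1 := by
    gcongr
    exact sin_sq_le_one w
  linarith

theorem angleEnergy_neg (lam w : ℝ) : angleEnergy lam (-w) = angleEnergy lam w := by
  simp [angleEnergy]

theorem angleEnergy_abs (lam w : ℝ) : angleEnergy lam |w| = angleEnergy lam w := by
  rcases abs_choice w with h | h <;> simp [h, angleEnergy_neg]

theorem angleEnergy_zero (lam : ℝ) : angleEnergy lam 0 = 1 := by simp [angleEnergy]

theorem continuous_angleEnergy (lam : ℝ) : Continuous (angleEnergy lam) := by
  unfold angleEnergy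
  fun_prop

theorem contDiff_angleEnergy {lam : ℝ} (hlam : 0 ≤ lam) {n : WithTop ℕ∞} :
    ContDiff ℝ n (angleEnergy lam) := by
  unfold angleEnergy
  exact ContDiff.sqrt (by fun_prop) fun w => (angleEnergy_radicand_pos hlam w).ne'

theorem angleEnergy_le_of_abs_le {lam : ℝ} (hlam : 0 ≤ lam) {w w' : ℝ} (h : |w| ≤ |w'|)
    (h' : |w'| ≤ π / 2) : angleEnergy lam w ≤ angleEnergy lam w' := by
  rw [← angleEnergy_abs lam w, ← angleEnergy_abs lam w']
  apply Real.sqrt_le_sqrt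
  have h0 : 0 ≤ sin |w| := sin_nonneg_of_nonneg_of_le_pi (abs_nonneg _) (by linarith [pi_pos])
  have h1 : sin |w| ≤ sin |w'| :=
    sin_le_sin_of_le_of_le_pi_div_two (by linarith [pi_pos, abs_nonneg w]) h' h
  gcongr

/-- The right-hand side of the Bethe equation in terms of `x = Δ + L / 2`, `L = 2 m + 1`. -/
noncomputable def energySum (lam : ℝ) (m : ℕ) (x : ℝ) : ℝ :=
  ∑ n ∈ Finset.Icc (-(m : ℤ)) m, angleEnergy lam (2 * π * n / x)

theorem card_Icc_neg_self (m : ℕ) : (Finset.Icc (-(m : ℤ)) m).card = 2 * m + 1 := by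
  rw [Int.card_Icc]
  omega

theorem isHighestEnergy_iff (lam : ℝ) (m : ℕ) (Del : ℝ) :
    IsHighestEnergy (2 * m + 1) lam Del ↔
      Del + ((2 * m + 1 : ℕ) : ℝ) / 2 ≠ 0 ∧ Del + ((2 * m + 1 : ℕ) : ℝ) / 2 =
        ((2 * m + 1 : ℕ) : ℝ) + energySum lam m (Del + ((2 * m + 1 : ℕ) : ℝ) / 2) := by
  have hm : (((2 * m + 1 : ℕ) : ℤ) - 1) / 2 = m := by omega
  rw [IsHighestEnergy, hm, energySum]
  have : ∀ n : ℤ, dispersion lam (betheMomentum (2 * m + 1) Del n) =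
      angleEnergy lam (2 * π * n / (Del + ((2 * m + 1 : ℕ) : ℝ) / 2)) := by
    intro n
    rw [dispersion_eq_angleEnergy, betheMomentum]
    congr 1
    ring
  simp only [this]
  constructor <;> rintro ⟨h0, h⟩ <;> exact ⟨h0, by linarith⟩

theorem le_energySum {lam : ℝ} (hlam : 0 ≤ lam) (m : ℕ) (x : ℝ) :
    ((2 * m + 1 : ℕ) : ℝ) ≤ energySum lam m x := by
  have := Finset.card_nsmul_le_sum (Finset.Icc (-(m : ℤ)) m)
    (fun n : ℤ => angleEnergy lam (2 * π * n / x)) 1 fun n _ => one_le_angleEnergy hlam _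
  rwa [card_Icc_neg_self, nsmul_eq_mul, mul_one] at this

theorem energySum_le {lam : ℝ} (hlam : 0 ≤ lam) (m : ℕ) (x : ℝ) :
    energySum lam m x ≤ ((2 * m + 1 : ℕ) : ℝ) * √(1 + lam / π ^ 2) := by
  have := Finset.sum_le_card_nsmul (Finset.Icc (-(m : ℤ)) m)
    (fun n : ℤ => angleEnergy lam (2 * π * n / x)) _ fun n _ => angleEnergy_le hlam _
  rwa [card_Icc_neg_self, nsmul_eq_mul] at this

/-- For `x ≥ 2L` all half momenta have modulus at most `π/2`, and they shrink as `x` grows, so every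
summand decreases. -/
theorem energySum_antitoneOn {lam : ℝ} (hlam : 0 ≤ lam) (m : ℕ) :
    AntitoneOn (energySum lam m) (Set.Ici (2 * ((2 * m + 1 : ℕ) : ℝ))) := by
  intro x hx y hy hxy
  have hx' : 2 * ((2 * m + 1 : ℕ) : ℝ) ≤ x := hx
  push_cast at hx'
  have hx0 : 0 < x := by linarith [(Nat.cast_nonneg m : (0 : ℝ) ≤ m)]
  apply Finset.sum_le_sum
  intro n hn
  have hn' : |(n : ℝ)| ≤ m := by
    have := Finset.mem_Icc.1 hn
    exact_mod_cast abs_le.2 this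
  have hpi := pi_pos
  have key : ∀ z : ℝ, 0 < z → |2 * π * n / z| = 2 * π * |(n : ℝ)| / z := by
    intro z hz
    rw [abs_div, abs_mul, abs_of_pos hz, abs_of_pos (by positivity : (0 : ℝ) < 2 * π)]
  apply angleEnergy_le_of_abs_le hlam
  · rw [key x hx0, key y (hx0.trans_le hxy)]
    gcongr
  · rw [key x hx0, div_le_iff₀ hx0]
    nlinarith

theorem continuousOn_energySum (lam : ℝ) (m : ℕ) : ContinuousOn (energySum lam m) (Set.Ioi 0) := by
  unfold energySum
  refine continuousOn_finsetSum _ fun n _ => ?_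
  refine (continuous_angleEnergy lam).comp_continuousOn ?_
  exact continuousOn_const.div continuousOn_id fun x hx => ne_of_gt hx

theorem existsUnique_isHighestEnergy {L : ℕ} (hL : Odd L) {lam : ℝ} (hlam : 0 ≤ lam) :
    ∃! Del : ℝ, IsHighestEnergy L lam Del := by
  obtain ⟨m, rfl⟩ := hL
  have hpos : (0 : ℝ) < ((2 * m + 1 : ℕ) : ℝ) := by positivity
  obtain ⟨x, hx, hxe, huniq⟩ := existsUnique_fixedPoint_of_antitoneOn
    (f := fun x => ((2 * m + 1 : ℕ) : ℝ) + energySum lam m x)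
    (c := 2 * ((2 * m + 1 : ℕ) : ℝ))
    (M := ((2 * m + 1 : ℕ) : ℝ) + ((2 * m + 1 : ℕ) : ℝ) * √(1 + lam / π ^ 2))
    (continuousOn_const.add ((continuousOn_energySum lam m).mono fun x hx =>
      Set.mem_Ioi.2 (by linarith [Set.mem_Ici.1 hx])))
    ((energySum_antitoneOn hlam m).const_add _)
    (fun x _ => by linarith [le_energySum hlam m x])
    (fun x _ => by linarith [energySum_le hlam m x])
  refine ⟨x - ((2 * m + 1 : ℕ) : ℝ) / 2, ?_, fun y hy => ?_⟩
  · beta_reduce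
    rw [isHighestEnergy_iff, sub_add_cancel]
    exact ⟨by linarith, hxe⟩
  · replace hy := (isHighestEnergy_iff lam m y).1 hy
    -- The bound `energySum ≥ L` holds for every real `x`, so any solution automatically lies in `x
    -- ≥ 2L`, where uniqueness is known.
    have := huniq _ (by linarith [hy.2, le_energySum hlam m (y + ((2 * m + 1 : ℕ) : ℝ) / 2)]) hy.2
    linarith

/-- The primitive of `angleEnergy lam` vanishing at `0`. -/
noncomputable def energyIntegral (lam w : ℝ) : ℝ := ∫ θ in (0 : ℝ)..w, angleEnergy lam θ

theorem ellipticE_eq_energyIntegral (lam w : ℝ) :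
    ellipticE w (-lam / π ^ 2) = energyIntegral lam w := by
  simp only [ellipticE, energyIntegral, angleEnergy]
  congr 1
  ext θ
  congr 1
  ring

/-- On the fixed interval `[0, 1]` the parameter `u` enters only through the integrand, so
monotonicity and bounds can be read off pointwise. -/
theorem average_energyIntegral (lam : ℝ) {u : ℝ} (hu : u ≠ 0) :
    u / π * energyIntegral lam (π / u) = ∫ t in (0 : ℝ)..1, angleEnergy lam (π / u * t) := by
  have hpi := pi_ne_zero
  rw [intervalIntegral.integral_comp_mul_left (fun x => angleEnergy lam x)
    (div_ne_zero hpi hu), energyIntegral, mul_zero, mul_one, inv_div, smul_eq_mul]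

theorem isLeadingSolution_iff (lam u : ℝ) :
    IsLeadingSolution lam u ↔ u ≠ 0 ∧ u = 1 + ∫ t in (0 : ℝ)..1, angleEnergy lam (π / u * t) := by
  rw [IsLeadingSolution, ellipticE_eq_energyIntegral]
  refine and_congr_right fun hu => ?_
  rw [average_energyIntegral lam hu]

theorem intervalIntegrable_angleEnergy (lam c a b : ℝ) :
    IntervalIntegrable (fun t => angleEnergy lam (c * t)) MeasureTheory.volume a b :=
  ((continuous_angleEnergy lam).comp (continuous_const_mul c)).intervalIntegrable a b

theorem one_le_average {lam : ℝ} (hlam : 0 ≤ lam) (c : ℝ) :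
    1 ≤ ∫ t in (0 : ℝ)..1, angleEnergy lam (c * t) := by
  have := intervalIntegral.integral_mono_on zero_le_one (intervalIntegrable_const (c := (1 : ℝ)))
    (intervalIntegrable_angleEnergy lam c 0 1) fun t _ => one_le_angleEnergy hlam (c * t)
  simpa using this

theorem average_le {lam : ℝ} (hlam : 0 ≤ lam) (c : ℝ) :
    ∫ t in (0 : ℝ)..1, angleEnergy lam (c * t) ≤ √(1 + lam / π ^ 2) := by
  have := intervalIntegral.integral_mono_on zero_le_one
    (intervalIntegrable_angleEnergy lam c 0 1)
    (intervalIntegrable_const (c := √(1 + lam / π ^ 2))) fun t _ => angleEnergy_le hlam (c * t)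
  simpa using this

theorem average_antitoneOn {lam : ℝ} (hlam : 0 ≤ lam) :
    AntitoneOn (fun u => ∫ t in (0 : ℝ)..1, angleEnergy lam (π / u * t)) (Set.Ici 2) := by
  intro x hx y hy hxy
  have hx' : 2 ≤ x := hx
  have hpi := pi_pos
  refine intervalIntegral.integral_mono_on zero_le_one (intervalIntegrable_angleEnergy lam _ 0 1)
    (intervalIntegrable_angleEnergy lam _ 0 1) fun t ht => ?_
  have ht0 := ht.1
  have hx0 : 0 < x := by linarith
  have hy0 : 0 < y := by linarith
  apply angleEnergy_le_of_abs_le hlam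
  · rw [abs_of_nonneg (by positivity), abs_of_nonneg (by positivity)]
    gcongr
  · rw [abs_of_nonneg (by positivity)]
    calc π / x * t ≤ π / 2 * 1 := by gcongr; exact ht.2
      _ = π / 2 := mul_one _

theorem hasDerivAt_energyIntegral (lam w : ℝ) :
    HasDerivAt (energyIntegral lam) (angleEnergy lam w) w :=
  intervalIntegral.integral_hasDerivAt_right ((continuous_angleEnergy lam).intervalIntegrable _ _)
    ((continuous_angleEnergy lam).stronglyMeasurableAtFilter _ _)
    (continuous_angleEnergy lam).continuousAt

theorem continuous_energyIntegral (lam : ℝ) : Continuous (energyIntegral lam) :=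
  continuous_iff_continuousAt.2 fun w => (hasDerivAt_energyIntegral lam w).continuousAt

theorem existsUnique_isLeadingSolution {lam : ℝ} (hlam : 0 ≤ lam) :
    ∃! u : ℝ, IsLeadingSolution lam u := by
  have hcont : ContinuousOn (fun u => 1 + ∫ t in (0 : ℝ)..1, angleEnergy lam (π / u * t))
      (Set.Ici 2) := by
    have hne : ∀ x ∈ Set.Ici (2 : ℝ), x ≠ 0 := fun x hx => by
      have : (2 : ℝ) ≤ x := hx
      linarith
    have h : ContinuousOn (fun u => 1 + u / π * energyIntegral lam (π / u)) (Set.Ici 2) :=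
      continuousOn_const.add ((continuousOn_id.div_const _).mul
        ((continuous_energyIntegral lam).comp_continuousOn
          (continuousOn_const.div continuousOn_id hne)))
    exact h.congr fun x hx => by
      beta_reduce
      rw [average_energyIntegral lam (hne x hx)]
  obtain ⟨x, hx, hxe, huniq⟩ := existsUnique_fixedPoint_of_antitoneOn
    (M := 1 + √(1 + lam / π ^ 2)) hcont ((average_antitoneOn hlam).const_add _)
    (fun x _ => by linarith [one_le_average hlam (π / x)])
    (fun x _ => by linarith [average_le hlam (π / x)])
  refine ⟨x, (isLeadingSolution_iff lam x).2 ⟨by linarith, hxe⟩, fun y hy => ?_⟩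
  replace hy := (isLeadingSolution_iff lam y).1 hy
  exact huniq y (by linarith [hy.2, one_le_average hlam (π / y)]) hy.2

theorem IsLeadingSolution.two_le {lam u : ℝ} (hlam : 0 ≤ lam) (h : IsLeadingSolution lam u) :
    2 ≤ u := by
  have := ((isLeadingSolution_iff lam u).1 h).2
  linarith [one_le_average hlam (π / u)]

theorem IsHighestEnergy.le_add {lam Del : ℝ} {m : ℕ} (hlam : 0 ≤ lam)
    (h : IsHighestEnergy (2 * m + 1) lam Del) :
    2 * ((2 * m + 1 : ℕ) : ℝ) ≤ Del + ((2 * m + 1 : ℕ) : ℝ) / 2 := by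
  have := ((isHighestEnergy_iff lam m Del).1 h).2
  linarith [le_energySum hlam m (Del + ((2 * m + 1 : ℕ) : ℝ) / 2)]

/-! ### Error expansion of the midpoint rule -/

theorem ContDiff.deriv_of_infty {F : ℝ → ℝ} (hF : ContDiff ℝ ∞ F) :
    ContDiff ℝ ∞ (deriv F) := (contDiff_infty_iff_deriv.1 hF).2

theorem ContDiff.iteratedDeriv_of_infty {F : ℝ → ℝ} (hF : ContDiff ℝ ∞ F) (i : ℕ) :
    ContDiff ℝ ∞ (iteratedDeriv i F) := by
  induction i generalizing F with
  | zero => simpa using hF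
  | succ i ih =>
    rw [iteratedDeriv_succ']
    exact ih hF.deriv_of_infty

/-- Taylor's formula with a remainder that is uniform in the base point. -/
theorem exists_uniform_taylor_bound (N : ℕ) {F : ℝ → ℝ} (hF : ContDiff ℝ ∞ F) (B : ℝ) :
    ∃ C, 0 ≤ C ∧ ∀ y τ : ℝ, |y| ≤ B → |τ| ≤ 1 →
      |F (y + τ) - ∑ i ∈ Finset.range N, iteratedDeriv i F y / i.factorial * τ ^ i|
        ≤ C * |τ| ^ N := by
  induction N generalizing F with
  | zero =>
    obtain ⟨C, hC⟩ := (isCompact_Icc (a := -(B + 1)) (b := B + 1)).exists_bound_of_continuousOn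
      hF.continuous.continuousOn
    refine ⟨|C|, abs_nonneg _, fun y τ hy hτ => ?_⟩
    have hmem : y + τ ∈ Set.Icc (-(B + 1)) (B + 1) := by
      rw [abs_le] at hy hτ
      constructor <;> linarith [hy.1, hy.2, hτ.1, hτ.2]
    simpa using (hC _ hmem).trans (le_abs_self C)
  | succ N ih =>
    obtain ⟨C, hC0, hC⟩ := ih hF.deriv_of_infty
    refine ⟨C, hC0, fun y τ hy hτ => ?_⟩
    set R : ℝ → ℝ := fun σ => F (y + σ) -
      ∑ i ∈ Finset.range (N + 1), iteratedDeriv i F y / i.factorial * σ ^ i with hR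
    -- The derivative of the remainder of order `N + 1` of `F` is the remainder of order `N` of
    -- `F'`; the mean value inequality then gains one power of `τ`.
    have hderiv : ∀ σ : ℝ, HasDerivAt R (deriv F (y + σ) -
        ∑ i ∈ Finset.range N, iteratedDeriv i (deriv F) y / i.factorial * σ ^ i) σ := by
      intro σ
      have h1 : HasDerivAt (fun σ => F (y + σ)) (deriv F (y + σ)) σ := by
        have := (hF.differentiable (by simp) (y + σ)).hasDerivAt.comp σ
          ((hasDerivAt_id σ).const_add y)
        simpa [Function.comp_def] using this
      have h2 : HasDerivAt (fun σ : ℝ => ∑ i ∈ Finset.range (N + 1),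
          iteratedDeriv i F y / i.factorial * σ ^ i)
          (∑ i ∈ Finset.range N, iteratedDeriv i (deriv F) y / i.factorial * σ ^ i) σ := by
        have := HasDerivAt.fun_sum (u := Finset.range (N + 1))
          (A := fun i (σ : ℝ) => iteratedDeriv i F y / i.factorial * σ ^ i)
          (A' := fun i => iteratedDeriv i F y / i.factorial * (i * σ ^ (i - 1))) (x := σ)
          fun i _ => (hasDerivAt_pow i σ).const_mul _
        refine this.congr_deriv ?_
        rw [Finset.sum_range_succ']
        simp only [Nat.cast_zero, zero_mul, mul_zero, add_zero, Nat.add_sub_cancel]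
        refine Finset.sum_congr rfl fun i _ => ?_
        rw [← iteratedDeriv_succ', Nat.factorial_succ]
        push_cast
        have : (i.factorial : ℝ) ≠ 0 := by positivity
        have : (i : ℝ) + 1 ≠ 0 := by positivity
        field_simp
      exact h1.sub h2
    have hR0 : R 0 = 0 := by
      simp [hR, Finset.sum_range_succ']
    have hmv := (convex_closedBall (0 : ℝ) |τ|).norm_image_sub_le_of_norm_hasDerivWithin_le
      (f := R) (C := C * |τ| ^ N) (x := 0) (y := τ)
      (fun σ _ => (hderiv σ).hasDerivWithinAt) (fun σ hσ => ?_) (by simp)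
      (by simp)
    · rw [hR0, sub_zero, sub_zero, Real.norm_eq_abs, Real.norm_eq_abs] at hmv
      rw [pow_succ, ← mul_assoc]
      exact hmv
    · have hσ' : |σ| ≤ |τ| := by simpa using hσ
      rw [Real.norm_eq_abs]
      refine (hC y σ hy (hσ'.trans hτ)).trans ?_
      gcongr

/-- The midpoint rule with step `s` for `2 m + 1` cells centred at the origin. -/
noncomputable def midpointSum (F : ℝ → ℝ) (m : ℕ) (s : ℝ) : ℝ :=
  s * ∑ n ∈ Finset.Icc (-(m : ℤ)) m, F (s * n)

/-- Telescoping: the right end of cell `n` is the left end of cell `n + 1`. -/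
theorem sum_Icc_neg_sub_eq (f : ℝ → ℝ) (s : ℝ) (m : ℕ) :
    ∑ n ∈ Finset.Icc (-(m : ℤ)) m, (f (s * n + s / 2) - f (s * n - s / 2)) =
      f (s * (2 * m + 1) / 2) - f (-(s * (2 * m + 1) / 2)) := by
  induction m with
  | zero =>
    simp only [Nat.cast_zero, neg_zero, Finset.Icc_self, Finset.sum_singleton, Int.cast_zero]
    congr 2 <;> ring
  | succ m ih =>
    push_cast
    rw [Finset.sum_Icc_succ_eq_add_endpoints, ih]
    push_cast
    have h1 : s * ((m : ℝ) + 1) - s / 2 = s * (2 * m + 1) / 2 := by ring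
    have h2 : s * (-1 + -(m : ℝ)) + s / 2 = -(s * (2 * m + 1) / 2) := by ring
    have h3 : s * ((m : ℝ) + 1) + s / 2 = s * (2 * (m + 1) + 1) / 2 := by ring
    have h4 : s * (-1 + -(m : ℝ)) - s / 2 = -(s * (2 * (m + 1) + 1) / 2) := by ring
    have h5 : -((m : ℝ) + 1) = -1 + -(m : ℝ) := by ring
    rw [h5, h1, h2, h3, h4]
    ring

/-- The Taylor coefficients of `H (y + s / 2) - H (y - s / 2)` in terms of those of `H'`. -/
noncomputable def cellCoeff (i : ℕ) : ℝ :=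
  ((1 / 2) ^ (i + 1) - (-1 / 2) ^ (i + 1)) / (i + 1).factorial

theorem cellCoeff_zero : cellCoeff 0 = 1 := by norm_num [cellCoeff]

theorem cellCoeff_one : cellCoeff 1 = 0 := by norm_num [cellCoeff]

theorem cellCoeff_two : cellCoeff 2 = 1 / 24 := by norm_num [cellCoeff, Nat.factorial]

theorem contDiff_of_hasDerivAt {F H : ℝ → ℝ} (hF : ContDiff ℝ ∞ F)
    (hH : ∀ y, HasDerivAt H (F y) y) : ContDiff ℝ ∞ H := by
  rw [contDiff_infty_iff_deriv]
  refine ⟨fun y => (hH y).differentiableAt, ?_⟩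
  rwa [show deriv H = F from funext fun y => (hH y).deriv]

theorem abs_mul_intCast_le {s B : ℝ} {m : ℕ} {n : ℤ} (hs : 0 < s)
    (hb : s * (2 * m + 1) / 2 ≤ B) (hn : n ∈ Finset.Icc (-(m : ℤ)) m) : |s * n| ≤ B := by
  have hn' : |(n : ℝ)| ≤ m := by
    have := Finset.mem_Icc.1 hn
    exact_mod_cast abs_le.2 this
  rw [abs_mul, abs_of_pos hs]
  nlinarith

/-- The increment of `H` is telescoped over the cells, and on each cell `H` is expanded at the
centre. What appears are midpoint sums of the derivatives of `F`, and symmetry kills the odd ones.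
-/
theorem exists_cell_sum_bound {F H : ℝ → ℝ} (hF : ContDiff ℝ ∞ F)
    (hH : ∀ y, HasDerivAt H (F y) y) (B : ℝ) (K : ℕ) :
    ∃ C, 0 ≤ C ∧ ∀ (m : ℕ) (s : ℝ), 0 < s → s ≤ 1 → s * (2 * m + 1) / 2 ≤ B →
      |H (s * (2 * m + 1) / 2) - H (-(s * (2 * m + 1) / 2)) -
        ∑ i ∈ Finset.range K, cellCoeff i * s ^ i * midpointSum (iteratedDeriv i F) m s|
        ≤ C * s ^ K := by
  obtain ⟨C, hC0, hC⟩ := exists_uniform_taylor_bound (K + 1) (contDiff_of_hasDerivAt hF hH) B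
  -- Each cell costs `2 C s ^ (K + 1)`, and there are at most `2 |B| / s` cells.
  refine ⟨4 * |B| * C, by positivity, fun m s hs hs1 hb => ?_⟩
  have hcell : ∀ n ∈ Finset.Icc (-(m : ℤ)) m, |(H (s * n + s / 2) - H (s * n - s / 2)) -
      ∑ i ∈ Finset.range K, cellCoeff i * s ^ (i + 1) * iteratedDeriv i F (s * n)|
        ≤ 2 * C * s ^ (K + 1) := by
    intro n hn
    have hy := abs_mul_intCast_le hs hb hn
    have hhalf : |s / 2| ≤ s := by
      rw [abs_of_pos (by positivity)]
      linarith
    have h1 := hC (s * n) (s / 2) hy (hhalf.trans hs1)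
    have h2 := hC (s * n) (-(s / 2)) hy (by rw [abs_neg]; exact hhalf.trans hs1)
    rw [abs_neg] at h2
    have hpow : C * |s / 2| ^ (K + 1) ≤ C * s ^ (K + 1) := by gcongr
    have hsum : ∑ i ∈ Finset.range K, cellCoeff i * s ^ (i + 1) * iteratedDeriv i F (s * n) =
        ∑ i ∈ Finset.range (K + 1), iteratedDeriv i H (s * n) / i.factorial * (s / 2) ^ i -
        ∑ i ∈ Finset.range (K + 1),
          iteratedDeriv i H (s * n) / i.factorial * (-(s / 2)) ^ i := by
      rw [← Finset.sum_sub_distrib, Finset.sum_range_succ']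
      simp only [pow_zero, mul_one, sub_self, add_zero]
      refine Finset.sum_congr rfl fun i _ => ?_
      rw [iteratedDeriv_succ', show deriv H = F from funext fun y => (hH y).deriv, cellCoeff,
        show s / 2 = 1 / 2 * s by ring, show -(1 / 2 * s) = -1 / 2 * s by ring, mul_pow, mul_pow]
      ring
    rw [hsum, sub_eq_add_neg (s * (n : ℝ)) (s / 2)]
    rw [abs_le] at h1 h2 ⊢
    constructor <;> linarith [h1.1, h1.2, h2.1, h2.2]
  have htotal := (Finset.abs_sum_le_sum_abs _ _).trans (Finset.sum_le_card_nsmul _ _ _ hcell)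
  rw [Finset.sum_sub_distrib, sum_Icc_neg_sub_eq, Finset.sum_comm, card_Icc_neg_self,
    nsmul_eq_mul] at htotal
  have hS : ∑ i ∈ Finset.range K, ∑ n ∈ Finset.Icc (-(m : ℤ)) m,
      cellCoeff i * s ^ (i + 1) * iteratedDeriv i F (s * n) =
      ∑ i ∈ Finset.range K, cellCoeff i * s ^ i * midpointSum (iteratedDeriv i F) m s := by
    refine Finset.sum_congr rfl fun i _ => ?_
    rw [midpointSum, ← Finset.mul_sum]
    ring
  rw [hS] at htotal
  refine htotal.trans ?_
  push_cast
  have hB : s * (2 * m + 1) ≤ 2 * |B| := by linarith [le_abs_self B]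
  calc (2 * (m : ℝ) + 1) * (2 * C * s ^ (K + 1)) = s * (2 * m + 1) * (2 * C * s ^ K) := by ring
    _ ≤ 2 * |B| * (2 * C * s ^ K) := by gcongr
    _ = _ := by ring

theorem exists_midpointSum_bound {F : ℝ → ℝ} (hF : Continuous F) (B : ℝ) :
    ∃ C, 0 ≤ C ∧ ∀ (m : ℕ) (s : ℝ), 0 < s → s * (2 * m + 1) / 2 ≤ B →
      |midpointSum F m s| ≤ C := by
  obtain ⟨C, hC⟩ := (isCompact_Icc (a := -B) (b := B)).exists_bound_of_continuousOn
    hF.continuousOn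
  refine ⟨2 * |B| * |C|, by positivity, fun m s hs hb => ?_⟩
  have h : ∀ n ∈ Finset.Icc (-(m : ℤ)) m, |F (s * n)| ≤ |C| := fun n hn =>
    (hC _ (abs_le.1 (abs_mul_intCast_le hs hb hn))).trans (le_abs_self C)
  have := (Finset.abs_sum_le_sum_abs _ _).trans (Finset.sum_le_card_nsmul _ _ _ h)
  rw [card_Icc_neg_self, nsmul_eq_mul] at this
  push_cast at this
  rw [midpointSum, abs_mul, abs_of_pos hs]
  have hB : s * (2 * m + 1) ≤ 2 * |B| := by linarith [le_abs_self B]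
  calc s * |∑ n ∈ Finset.Icc (-(m : ℤ)) m, F (s * n)| ≤ s * ((2 * m + 1) * |C|) := by gcongr
    _ = s * (2 * m + 1) * |C| := by ring
    _ ≤ 2 * |B| * |C| := by gcongr

/-- The midpoint sum agrees, to every order in the step, with a smooth function of the end point
and the step. -/
theorem exists_smooth_midpointSum_approx (K : ℕ) {F H : ℝ → ℝ} (hF : ContDiff ℝ ∞ F)
    (hH : ∀ y, HasDerivAt H (F y) y) (B : ℝ) :
    ∃ Φ : ℝ × ℝ → ℝ, ContDiff ℝ ∞ Φ ∧ (0 < K → ∀ b, Φ (b, 0) = H b - H (-b)) ∧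
      ∃ C, 0 ≤ C ∧ ∀ (m : ℕ) (s : ℝ), 0 < s → s ≤ 1 → s * (2 * m + 1) / 2 ≤ B →
        |midpointSum F m s - Φ (s * (2 * m + 1) / 2, s)| ≤ C * s ^ K := by
  induction K using Nat.strong_induction_on generalizing F H with
  | _ K ih =>
  rcases Nat.eq_zero_or_pos K with rfl | hK
  · obtain ⟨C, hC0, hC⟩ := exists_midpointSum_bound hF.continuous B
    refine ⟨fun _ => 0, contDiff_const, fun h => absurd h (lt_irrefl _), C, hC0,
      fun m s hs _ hb => ?_⟩
    simpa using hC m s hs hb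
  · obtain ⟨J, rfl⟩ : ∃ J, K = J + 1 := ⟨K - 1, by omega⟩
    have hder : ∀ i y, HasDerivAt (iteratedDeriv i F) (iteratedDeriv (i + 1) F y) y := by
      intro i y
      rw [iteratedDeriv_succ]
      exact ((hF.iteratedDeriv_of_infty i).differentiable (by simp) y).hasDerivAt
    -- The cell identity is solved for its term `i = 0`. The midpoint sum of the derivative of order
    -- `i + 1` carries a factor `s ^ (i + 1)`, so it is needed only to order `J - i`, which the
    -- induction supplies. Only `i < J` is used later.
    have hrec : ∀ i, ∃ Φ : ℝ × ℝ → ℝ, ContDiff ℝ ∞ Φ ∧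
        ∃ C, 0 ≤ C ∧ ∀ (m : ℕ) (s : ℝ), 0 < s → s ≤ 1 → s * (2 * m + 1) / 2 ≤ B →
          |midpointSum (iteratedDeriv (i + 1) F) m s - Φ (s * (2 * m + 1) / 2, s)|
            ≤ C * s ^ (J - i) := by
      intro i
      obtain ⟨Φ, h1, -, h2⟩ := ih (J - i) (by omega) (hF.iteratedDeriv_of_infty (i + 1)) (hder i)
      exact ⟨Φ, h1, h2⟩
    choose Φ hΦ C hC0 hC using hrec
    obtain ⟨C', hC'0, hC'⟩ := exists_cell_sum_bound hF hH B (J + 1)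
    have hHs : ContDiff ℝ ∞ H := contDiff_of_hasDerivAt hF hH
    refine ⟨fun p => H p.1 - H (-p.1) -
      ∑ i ∈ Finset.range J, cellCoeff (i + 1) * p.2 ^ (i + 1) * Φ i p, ?_, fun _ b => by simp,
      C' + ∑ i ∈ Finset.range J, |cellCoeff (i + 1)| * C i, ?_, fun m s hs hs1 hb => ?_⟩
    · refine ((hHs.comp contDiff_fst).sub (hHs.comp contDiff_fst.neg)).sub
        (ContDiff.sum fun i _ => ?_)
      exact (contDiff_const.mul (contDiff_snd.pow _)).mul (hΦ i)
    · exact add_nonneg hC'0 (Finset.sum_nonneg fun i _ => mul_nonneg (abs_nonneg _) (hC0 i))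
    · have h1 := hC' m s hs hs1 hb
      rw [Finset.sum_range_succ', cellCoeff_zero, pow_zero, one_mul, one_mul,
        iteratedDeriv_zero] at h1
      have h2 : |∑ i ∈ Finset.range J, cellCoeff (i + 1) * s ^ (i + 1) *
          (midpointSum (iteratedDeriv (i + 1) F) m s - Φ i (s * (2 * m + 1) / 2, s))| ≤
          ∑ i ∈ Finset.range J, |cellCoeff (i + 1)| * C i * s ^ (J + 1) := by
        refine (Finset.abs_sum_le_sum_abs _ _).trans (Finset.sum_le_sum fun i hi => ?_)
        rw [abs_mul, abs_mul, abs_of_pos (pow_pos hs _)]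
        have hiJ : J + 1 = i + 1 + (J - i) := by
          have := Finset.mem_range.1 hi
          omega
        calc |cellCoeff (i + 1)| * s ^ (i + 1) * |midpointSum (iteratedDeriv (i + 1) F) m s -
              Φ i (s * (2 * m + 1) / 2, s)|
            ≤ |cellCoeff (i + 1)| * s ^ (i + 1) * (C i * s ^ (J - i)) := by
              gcongr
              exact hC i m s hs hs1 hb
          _ = |cellCoeff (i + 1)| * C i * s ^ (J + 1) := by
              rw [hiJ, pow_add]
              ring
      rw [← Finset.sum_mul] at h2
      simp only [mul_sub, Finset.sum_sub_distrib] at h2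
      rw [abs_le] at h1 h2 ⊢
      constructor <;> linarith [h1.1, h1.2, h2.1, h2.2]

/-- The midpoint rule with its first correction. -/
theorem exists_midpointSum_second_order {F H : ℝ → ℝ} (hF : ContDiff ℝ ∞ F)
    (hH : ∀ y, HasDerivAt H (F y) y) (B : ℝ) :
    ∃ C, 0 ≤ C ∧ ∀ (m : ℕ) (s : ℝ), 0 < s → s ≤ 1 → s * (2 * m + 1) / 2 ≤ B →
      |midpointSum F m s - (H (s * (2 * m + 1) / 2) - H (-(s * (2 * m + 1) / 2)) - s ^ 2 / 24 *
        (deriv F (s * (2 * m + 1) / 2) - deriv F (-(s * (2 * m + 1) / 2))))| ≤ C * s ^ 3 := by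
  have hder : ∀ y, HasDerivAt (deriv F) (iteratedDeriv 2 F y) y := by
    intro y
    rw [iteratedDeriv_succ, iteratedDeriv_one]
    exact (hF.deriv_of_infty.differentiable (by simp) y).hasDerivAt
  obtain ⟨C, hC0, hC⟩ := exists_cell_sum_bound hF hH B 3
  -- Order one suffices for `F''`, with primitive `F'`, because its midpoint sum enters multiplied
  -- by `s ^ 2 / 24`.
  obtain ⟨C', hC'0, hC'⟩ := exists_cell_sum_bound (hF.iteratedDeriv_of_infty 2) hder B 1
  refine ⟨C + C' / 24, by positivity, fun m s hs hs1 hb => ?_⟩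
  have h1 := hC m s hs hs1 hb
  have h2 := hC' m s hs hs1 hb
  simp only [Finset.sum_range_succ, Finset.sum_range_zero, cellCoeff_zero, cellCoeff_one,
    cellCoeff_two, iteratedDeriv_zero, pow_zero, pow_one, one_mul, zero_mul, zero_add,
    add_zero] at h1 h2
  have h3 := mul_le_mul_of_nonneg_left h2 (by positivity : 0 ≤ s ^ 2 / 24)
  rw [← abs_of_nonneg (by positivity : 0 ≤ s ^ 2 / 24), ← abs_mul,
    abs_of_nonneg (by positivity : 0 ≤ s ^ 2 / 24)] at h3
  rw [abs_le] at h1 h3 ⊢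
  constructor <;> nlinarith [h1.1, h1.2, h3.1, h3.2]

/-! ### Asymptotic power expansions and approximate implicit equations -/

section PowerExpansions

variable {α : Type*} {l : Filter α}

theorem isBigO_sub_sum_of_le {ε v : α → ℝ} (hε : Tendsto ε l (𝓝 0)) {c : ℕ → ℝ} {M N : ℕ}
    (hMN : M ≤ N)
    (h : (fun i => v i - ∑ n ∈ Finset.range N, c n * ε i ^ n) =O[l] fun i => ε i ^ N) :
    (fun i => v i - ∑ n ∈ Finset.range M, c n * ε i ^ n) =O[l] fun i => ε i ^ M := by
  have hpow : ∀ {a b : ℕ}, a ≤ b → (fun i => ε i ^ b) =O[l] fun i => ε i ^ a := by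
    intro a b hab
    obtain ⟨k, rfl⟩ := Nat.exists_eq_add_of_le hab
    have h1 : (fun i => ε i ^ k) =O[l] fun _ => (1 : ℝ) := by
      simpa using (hε.isBigO_one ℝ).pow k
    simpa [pow_add] using (isBigO_refl (fun i => ε i ^ a) l).mul h1
  have hsum : (fun i => ∑ n ∈ Finset.Ico M N, c n * ε i ^ n) =O[l] fun i => ε i ^ M :=
    IsBigO.fun_sum fun n hn => (hpow (Finset.mem_Ico.1 hn).1).const_mul_left _
  refine ((h.trans (hpow hMN)).add hsum).congr_left fun i => ?_
  rw [← Finset.sum_range_add_sum_Ico _ hMN]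
  ring

/-- Uniqueness of asymptotic coefficients: the limit gives `d 0 = 0`; then divide by `ε` and induct.
-/
theorem eq_zero_of_isBigO_sum [l.NeBot] {ε : α → ℝ} (hε : Tendsto ε l (𝓝 0))
    (hne : ∀ᶠ i in l, ε i ≠ 0) (N : ℕ) {d : ℕ → ℝ}
    (h : (fun i => ∑ n ∈ Finset.range N, d n * ε i ^ n) =O[l] fun i => ε i ^ N) :
    ∀ n < N, d n = 0 := by
  induction N generalizing d with
  | zero => simp
  | succ N ih =>
    have hlim : Tendsto (fun i => ∑ n ∈ Finset.range (N + 1), d n * ε i ^ n) l (𝓝 (d 0)) := by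
      have : Tendsto (fun i => ∑ n ∈ Finset.range (N + 1), d n * ε i ^ n) l
          (𝓝 (∑ n ∈ Finset.range (N + 1), d n * 0 ^ n)) :=
        tendsto_finsetSum _ fun n _ => (hε.pow n).const_mul _
      simpa [Finset.sum_range_succ'] using this
    have hzero : Tendsto (fun i => ∑ n ∈ Finset.range (N + 1), d n * ε i ^ n) l (𝓝 0) :=
      h.trans_tendsto (by simpa using hε.pow (N + 1))
    have hd0 : d 0 = 0 := tendsto_nhds_unique hlim hzero
    have hshift : (fun i => ∑ n ∈ Finset.range N, d (n + 1) * ε i ^ n) =O[l]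
        fun i => ε i ^ N := by
      have := h.mul (isBigO_refl (fun i => (ε i)⁻¹) l)
      refine (this.congr' ?_ ?_)
      · filter_upwards [hne] with i hi
        rw [Finset.sum_range_succ', hd0, zero_mul, add_zero, Finset.sum_mul]
        refine Finset.sum_congr rfl fun n _ => ?_
        rw [pow_succ, ← mul_assoc, mul_inv_cancel_right₀ hi]
      · filter_upwards [hne] with i hi
        rw [pow_succ, mul_inv_cancel_right₀ hi]
    intro n hn
    rcases n with _ | n
    · exact hd0
    · exact ih hshift n (by omega)

/-- Power expansions to every finite order fit together to one infinite expansion. -/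
theorem exists_coeff_of_forall_order [l.NeBot] {ε v : α → ℝ} (hε : Tendsto ε l (𝓝 0))
    (hne : ∀ᶠ i in l, ε i ≠ 0)
    (h : ∀ N, ∃ c : ℕ → ℝ,
      (fun i => v i - ∑ n ∈ Finset.range N, c n * ε i ^ n) =O[l] fun i => ε i ^ N) :
    ∃ z : ℕ → ℝ, ∀ N,
      (fun i => v i - ∑ n ∈ Finset.range N, z n * ε i ^ n) =O[l] fun i => ε i ^ N := by
  choose c hc using h
  -- Diagonal choice. By uniqueness, `c N n` is the same for every `N > n`.
  refine ⟨fun n => c (n + 1) n, fun N => (hc N).congr_left fun i => ?_⟩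
  congr 1
  refine Finset.sum_congr rfl fun n hn => ?_
  have h1 := isBigO_sub_sum_of_le hε (Nat.succ_le_of_lt (Finset.mem_range.1 hn)) (hc N)
  have h2 := (hc (n + 1)).sub h1
  have h3 : (fun i => ∑ k ∈ Finset.range (n + 1), (c N k - c (n + 1) k) * ε i ^ k) =O[l]
      fun i => ε i ^ (n + 1) := by
    refine h2.congr_left fun i => ?_
    simp only [sub_mul, Finset.sum_sub_distrib]
    ring
  have := eq_zero_of_isBigO_sum hε hne (n + 1) h3 n (Nat.lt_succ_self n)
  rw [sub_eq_zero.1 this]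

theorem exists_taylor_coeff {V : ℝ → ℝ} (hV : ContDiffAt ℝ ∞ V 0) (N : ℕ) :
    ∃ c : ℕ → ℝ, (fun x => V x - ∑ n ∈ Finset.range N, c n * x ^ n) =O[𝓝 0] fun x => x ^ N := by
  obtain ⟨t, ht, hVt⟩ := (hV.of_le (by exact_mod_cast le_top) : ContDiffAt ℝ N V 0).contDiffOn
    le_rfl (by simp)
  obtain ⟨r, hr, hrt⟩ := Metric.mem_nhds_iff.1 ht
  have h := taylor_isLittleO (convex_ball (0 : ℝ) r) (Metric.mem_ball_self hr) (hVt.mono hrt)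
  rw [nhdsWithin_eq_nhds.2 (Metric.ball_mem_nhds 0 hr)] at h
  refine ⟨fun n => (n.factorial : ℝ)⁻¹ * iteratedDerivWithin n V (Metric.ball 0 r) 0, ?_⟩
  refine isBigO_sub_sum_of_le tendsto_id (Nat.le_refl N) ?_
  -- The Taylor polynomial of degree `N` leaves `o(x ^ N)`; its top term is moved into the error,
  -- which becomes `O(x ^ N)`.
  have h2 : (fun x : ℝ => ((N.factorial : ℝ)⁻¹ * iteratedDerivWithin N V (Metric.ball 0 r) 0) *
      x ^ N) =O[𝓝 0] fun x => x ^ N := (isBigO_refl _ _).const_mul_left _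
  refine ((h.isBigO.congr_right fun x => by rw [sub_zero]).add h2).congr_left fun x => ?_
  rw [taylor_within_apply, Finset.sum_range_succ]
  simp only [smul_eq_mul, sub_zero, id]
  have : ∀ n : ℕ, (n.factorial : ℝ)⁻¹ * x ^ n * iteratedDerivWithin n V (Metric.ball 0 r) 0 =
    (n.factorial : ℝ)⁻¹ * iteratedDerivWithin n V (Metric.ball 0 r) 0 * x ^ n := fun n => by ring
  simp only [this]
  ring

/-- An approximate solution of a smooth implicit equation is approximated by the values of a
smooth function. -/
theorem exists_contDiffAt_approx_of_implicit {f : ℝ × ℝ → ℝ} {u c : ℝ}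
    (hf : ContDiffAt ℝ ∞ f (0, u)) (hfu : f (0, u) = 0)
    (hfc : HasDerivAt (fun v => f (0, v)) c u) (hc : c ≠ 0) {ε v g : α → ℝ}
    (hε : Tendsto ε l (𝓝 0)) (hv : Tendsto v l (𝓝 u)) (hg : Tendsto g l (𝓝 0))
    (hO : (fun i => f (ε i, v i)) =O[l] g) :
    ∃ V : ℝ → ℝ, ContDiffAt ℝ ∞ V 0 ∧ (fun i => v i - V (ε i)) =O[l] g := by
  -- The defect `δ = f (ε, v)` is made a second parameter. Then `v = ψ (ε, δ)` holds exactly, `V x =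
  -- ψ (x, 0)`, and the local Lipschitz bound for `ψ` controls `v - V ε` by `δ`.
  set F : (ℝ × ℝ) × ℝ → ℝ := fun p => f (p.1.1, p.2) - p.1.2 with hF
  have hFs : ContDiffAt ℝ ∞ F ((0, 0), u) := by
    have h1 : ContDiffAt ℝ ∞ (fun p : (ℝ × ℝ) × ℝ => (p.1.1, p.2)) ((0, 0), u) := by fun_prop
    have h2 : ContDiffAt ℝ ∞ (fun p : (ℝ × ℝ) × ℝ => p.1.2) ((0, 0), u) := by fun_prop
    exact (ContDiffAt.comp (x := (((0 : ℝ), (0 : ℝ)), u)) (g := f) hf h1).sub h2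
  have hFu : F ((0, 0), u) = 0 := by simp [hF, hfu]
  -- The partial derivative in `v` is multiplication by `c ≠ 0`, hence invertible.
  have hcomp : fderiv ℝ F ((0, 0), u) ∘L .inr ℝ (ℝ × ℝ) ℝ =
      (ContinuousLinearEquiv.unitsEquivAut ℝ (Units.mk0 c hc) : ℝ →L[ℝ] ℝ) := by
    have h1 : HasDerivAt (fun v : ℝ => (((0 : ℝ), (0 : ℝ)), v)) (((0 : ℝ), (0 : ℝ)), (1 : ℝ)) u :=
      (hasDerivAt_const u ((0 : ℝ), (0 : ℝ))).prodMk (hasDerivAt_id u)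
    have h2 := HasFDerivAt.comp_hasDerivAt u
      (hFs.differentiableAt (by simp)).hasFDerivAt h1
    have h3 : HasDerivAt (F ∘ fun v : ℝ => (((0 : ℝ), (0 : ℝ)), v)) c u := by
      simpa [hF, Function.comp_def] using hfc
    have h4 : (ContinuousLinearEquiv.unitsEquivAut ℝ (Units.mk0 c hc) : ℝ →L[ℝ] ℝ) 1 = c := by
      simp
    ext
    exact (h2.unique h3).trans h4.symm
  have hinv : (fderiv ℝ F ((0, 0), u) ∘L .inr ℝ (ℝ × ℝ) ℝ).IsInvertible := by
    rw [hcomp]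
    exact ContinuousLinearMap.isInvertible_equiv
  have hn : (∞ : WithTop ℕ∞) ≠ 0 := by simp
  set ψ := hFs.implicitFunction hn hinv with hψ
  have hψs : ContDiffAt ℝ ∞ ψ (0, 0) := hFs.contDiffAt_implicitFunction hn hinv
  have hiff := hFs.eventually_apply_eq_iff_implicitFunction hn hinv
  have hδ : Tendsto (fun i => f (ε i, v i)) l (𝓝 0) := hO.trans_tendsto hg
  have hvψ : ∀ᶠ i in l, ψ (ε i, f (ε i, v i)) = v i := by
    have ht : Tendsto (fun i => ((ε i, f (ε i, v i)), v i)) l (𝓝 (((0 : ℝ), (0 : ℝ)), u)) :=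
      (hε.prodMk_nhds hδ).prodMk_nhds hv
    filter_upwards [ht.eventually hiff] with i hi
    exact hi.1 (by rw [hFu]; simp [hF])
  refine ⟨fun x => ψ (x, 0), ?_, ?_⟩
  · exact ContDiffAt.comp (x := (0 : ℝ)) (g := ψ) hψs (contDiffAt_id.prodMk contDiffAt_const)
  · obtain ⟨K, t, ht, hK⟩ := (hψs.of_le (by simp)).exists_lipschitzOnWith
    have ht1 := (hε.prodMk_nhds hδ).eventually ht
    have ht2 := (hε.prodMk_nhds (tendsto_const_nhds (x := (0 : ℝ)))).eventually ht
    refine IsBigO.trans (IsBigO.of_bound K ?_) hO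
    filter_upwards [hvψ, ht1, ht2] with i h1 h2 h3
    have := hK.dist_le_mul _ h2 _ h3
    rw [h1, Prod.dist_eq, dist_self, dist_zero_right, max_eq_right (norm_nonneg _),
      Real.dist_eq] at this
    exact this

end PowerExpansions

/-! ### The expansion in `1/L` at fixed coupling -/

instance neBot_oddAtTop : NeBot oddAtTop := by
  rw [oddAtTop, ← frequently_mem_iff_neBot]
  refine frequently_atTop.2 fun a => ⟨2 * a + 1, by omega, ?_⟩
  exact ⟨a, rfl⟩

theorem eventually_odd_oddAtTop : ∀ᶠ L in oddAtTop, Odd L :=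
  mem_inf_of_right (mem_principal_self _)

theorem eventually_ge_oddAtTop (k : ℕ) : ∀ᶠ L in oddAtTop, k ≤ L :=
  mem_inf_of_left (eventually_ge_atTop k)

theorem tendsto_natCast_oddAtTop : Tendsto (fun L : ℕ => (L : ℝ)) oddAtTop atTop :=
  tendsto_natCast_atTop_atTop.mono_left inf_le_left

theorem tendsto_inv_oddAtTop : Tendsto (fun L : ℕ => 1 / (L : ℝ)) oddAtTop (𝓝 0) := by
  simpa [Pi.inv_def] using tendsto_natCast_oddAtTop.inv_tendsto_atTop

theorem energySum_eq_midpointSum (lam : ℝ) (m : ℕ) {x : ℝ} (hx : x ≠ 0) :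
    energySum lam m x = x / (2 * π) * midpointSum (angleEnergy lam) m (2 * π / x) := by
  have hpi := pi_ne_zero
  rw [midpointSum, ← mul_assoc, div_mul_div_cancel₀ (by positivity), div_self hx, one_mul,
    energySum]
  refine Finset.sum_congr rfl fun n _ => ?_
  congr 1
  ring

/-- The Bethe equation for `v = Δ / L + 1 / 2`. -/
theorem IsHighestEnergy.scaled {lam D : ℝ} {L : ℕ} (hlam : 0 ≤ lam) (hL : Odd L)
    (h : IsHighestEnergy L lam D) :
    ∃ m : ℕ, (L : ℝ) = 2 * m + 1 ∧ 2 ≤ D / L + 1 / 2 ∧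
      D / L + 1 / 2 = 1 + (D / L + 1 / 2) / (2 * π) *
        midpointSum (angleEnergy lam) m (2 * π / (L * (D / L + 1 / 2))) := by
  obtain ⟨m, rfl⟩ := hL
  have hLpos : (0 : ℝ) < ((2 * m + 1 : ℕ) : ℝ) := by positivity
  have hx : D + ((2 * m + 1 : ℕ) : ℝ) / 2 =
      ((2 * m + 1 : ℕ) : ℝ) * (D / ((2 * m + 1 : ℕ) : ℝ) + 1 / 2) := by
    field_simp
  have h2 := h.le_add hlam
  obtain ⟨h0, h1⟩ := (isHighestEnergy_iff lam m D).1 h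
  refine ⟨m, by push_cast; ring, ?_, ?_⟩
  · rw [hx, mul_comm] at h2
    exact le_of_mul_le_mul_left h2 hLpos
  · rw [energySum_eq_midpointSum lam m h0, hx] at h1
    refine mul_left_cancel₀ hLpos.ne' (h1.trans ?_)
    ring

theorem energyIntegral_neg (lam w : ℝ) : energyIntegral lam (-w) = -energyIntegral lam w := by
  have h := intervalIntegral.integral_comp_neg (a := 0) (b := w) (angleEnergy lam)
  simp only [angleEnergy_neg, neg_zero] at h
  rw [energyIntegral, energyIntegral, h, intervalIntegral.integral_symm]

theorem hasDerivAt_angleEnergy {lam : ℝ} (hlam : 0 ≤ lam) (w : ℝ) :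
    HasDerivAt (angleEnergy lam)
      (lam / π ^ 2 * (2 * sin w * cos w) / (2 * angleEnergy lam w)) w := by
  have h1 : HasDerivAt (fun w => 1 + lam / π ^ 2 * sin w ^ 2)
      (lam / π ^ 2 * (2 * sin w * cos w)) w := by
    have := (((hasDerivAt_sin w).pow 2).const_mul (lam / π ^ 2)).const_add 1
    simpa using this
  exact h1.sqrt (angleEnergy_radicand_pos hlam w).ne'

theorem deriv_angleEnergy {lam : ℝ} (hlam : 0 ≤ lam) (w : ℝ) :
    deriv (angleEnergy lam) w = lam / (2 * π ^ 2) * sin (2 * w) / angleEnergy lam w := by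
  rw [(hasDerivAt_angleEnergy hlam w).deriv, sin_two_mul]
  field_simp

/-- The leading-order equation reads `leadingDefect lam u = 0`. -/
noncomputable def leadingDefect (lam v : ℝ) : ℝ := v - 1 - v / π * energyIntegral lam (π / v)

theorem IsLeadingSolution.leadingDefect_eq_zero {lam u : ℝ} (h : IsLeadingSolution lam u) :
    leadingDefect lam u = 0 := by
  have := h.2
  rw [ellipticE_eq_energyIntegral] at this
  rw [leadingDefect]
  linarith

theorem hasDerivAt_leadingDefect (lam : ℝ) {v : ℝ} (hv : v ≠ 0) :
    HasDerivAt (leadingDefect lam)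
      (1 - energyIntegral lam (π / v) / π + angleEnergy lam (π / v) / v) v := by
  have h1 : HasDerivAt (fun v : ℝ => π / v) (-π / v ^ 2) v := by
    simpa using (hasDerivAt_const v π).fun_div (hasDerivAt_id v) hv
  have h2 := (hasDerivAt_energyIntegral lam (π / v)).comp v h1
  have h3 := ((hasDerivAt_id v).sub_const 1).sub (((hasDerivAt_id v).div_const π).mul h2)
  refine h3.congr_deriv ?_
  have := pi_ne_zero
  simp only [id, Function.comp_apply]
  field_simp
  ring

/-- The equation for `u` turns `energyIntegral / π` into `1 - 1/u`. The resulting positive slope is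
the nondegeneracy required by the implicit function theorem and the denominator in `zTwo`. -/
theorem IsLeadingSolution.hasDerivAt_leadingDefect {lam u : ℝ} (h : IsLeadingSolution lam u) :
    HasDerivAt (leadingDefect lam) ((1 + angleEnergy lam (π / u)) / u) u := by
  refine (_root_.hasDerivAt_leadingDefect lam h.1).congr_deriv ?_
  have h1 := h.leadingDefect_eq_zero
  rw [leadingDefect] at h1
  have hu := h.1
  have hpi := pi_ne_zero
  field_simp at h1 ⊢
  linarith

/-- Stability: the average is antitone, so on `[2, ∞)` the defect grows at least as fast as `v`
itself. This converts a small residual into a small distance to `u`. -/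
theorem IsLeadingSolution.abs_sub_le {lam u v : ℝ} (hlam : 0 ≤ lam) (h : IsLeadingSolution lam u)
    (hv : 2 ≤ v) : |v - u| ≤ |leadingDefect lam v| := by
  have hu := h.two_le hlam
  have h0 := h.leadingDefect_eq_zero
  rw [leadingDefect, average_energyIntegral lam h.1] at h0
  rw [leadingDefect, average_energyIntegral lam (by linarith : v ≠ 0)]
  have ha := average_antitoneOn hlam
  rcases le_total u v with huv | huv
  · have := ha hu hv huv
    simp only at this
    rw [abs_of_nonneg (by linarith)]
    refine le_trans ?_ (le_abs_self _)
    linarith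
  · have := ha hv hu huv
    simp only at this
    rw [abs_of_nonpos (by linarith)]
    refine le_trans ?_ (neg_le_abs _)
    linarith

section FixedCoupling

variable {lam u : ℝ} {D : ℕ → ℝ}

/-- Since `v ≥ 2`, the end point `π / v` never exceeds `π / 2`, so the constants in the midpoint
estimates can be chosen independently of `L`. -/
theorem eventually_scaled (hlam : 0 ≤ lam) (hD : ∀ L, Odd L → IsHighestEnergy L lam (D L)) :
    ∀ᶠ L : ℕ in oddAtTop, 0 < (L : ℝ) ∧ 2 ≤ D L / L + 1 / 2 ∧ ∃ (m : ℕ) (s : ℝ),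
      0 < s ∧ s ≤ 1 ∧ s = 2 * π / (D L / L + 1 / 2) * (1 / L) ∧ s ≤ π * (1 / L) ∧
      s * (2 * m + 1) / 2 = π / (D L / L + 1 / 2) ∧ s * (2 * m + 1) / 2 ≤ π / 2 ∧
      D L / L + 1 / 2 = 1 + (D L / L + 1 / 2) / (2 * π) * midpointSum (angleEnergy lam) m s := by
  -- `L ≥ 4 ≥ π` makes the step `s ≤ π / L` at most 1.
  filter_upwards [eventually_odd_oddAtTop, eventually_ge_oddAtTop 4] with L hL h4
  obtain ⟨m, hm, hv, he⟩ := (hD L hL).scaled hlam hL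
  set v := D L / L + 1 / 2
  have hL4 : (4 : ℝ) ≤ L := by exact_mod_cast h4
  have hpi := pi_pos
  have hpi4 := pi_le_four
  have hL0 : (0 : ℝ) < L := by linarith
  have hv0 : 0 < v := by linarith
  have hb : 2 * π / (L * v) * (2 * m + 1) / 2 = π / v := by
    rw [← hm]
    field_simp
  have hsle : 2 * π / (L * v) ≤ π * (1 / L) := by
    rw [mul_one_div, div_le_div_iff₀ (by positivity) hL0]
    nlinarith [mul_pos hpi hL0]
  refine ⟨hL0, hv, m, 2 * π / (L * v), by positivity, hsle.trans ?_, ?_, hsle, hb, ?_, he⟩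
  · rw [mul_one_div, div_le_one hL0]
    linarith
  · field_simp
  · rw [hb]
    gcongr

theorem leadingDefect_eq (lam : ℝ) (v : ℝ) : leadingDefect lam v =
    v - (1 + v / (2 * π) * (energyIntegral lam (π / v) - energyIntegral lam (-(π / v)))) := by
  rw [leadingDefect, energyIntegral_neg]
  ring

theorem tendsto_scaled_energy (hlam : 0 ≤ lam) (hu : IsLeadingSolution lam u)
    (hD : ∀ L, Odd L → IsHighestEnergy L lam (D L)) :
    Tendsto (fun L : ℕ => D L / L + 1 / 2) oddAtTop (𝓝 u) := by
  obtain ⟨C, hC0, hC⟩ := exists_cell_sum_bound (contDiff_angleEnergy hlam)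
    (hasDerivAt_energyIntegral lam) (π / 2) 1
  have hb : ∀ᶠ L : ℕ in oddAtTop, |D L / L + 1 / 2 - u| ≤ C * (1 / L) := by
    filter_upwards [eventually_scaled hlam hD] with L ⟨hL0, hv, m, s, hs, hs1, hs2, _, hb, hb2, he⟩
    set v := D L / L + 1 / 2
    refine (hu.abs_sub_le hlam hv).trans ?_
    have h1 := hC m s hs hs1 hb2
    simp only [Finset.sum_range_one, cellCoeff_zero, iteratedDeriv_zero, pow_zero, pow_one,
      one_mul, hb] at h1
    have hv0 : 0 < v := by linarith
    have hpi := pi_pos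
    rw [leadingDefect_eq]
    have h2 : v - (1 + v / (2 * π) *
        (energyIntegral lam (π / v) - energyIntegral lam (-(π / v)))) =
        -(v / (2 * π) * (energyIntegral lam (π / v) - energyIntegral lam (-(π / v)) -
          midpointSum (angleEnergy lam) m s)) := by
      linear_combination he
    rw [h2, abs_neg, abs_mul, abs_of_pos (by positivity)]
    calc v / (2 * π) * |energyIntegral lam (π / v) - energyIntegral lam (-(π / v)) -
          midpointSum (angleEnergy lam) m s| ≤ v / (2 * π) * (C * s) := by gcongr
      _ = C * (1 / L) := by
        rw [hs2]
        field_simp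
  rw [tendsto_iff_norm_sub_tendsto_zero]
  refine squeeze_zero' (Eventually.of_forall fun _ => norm_nonneg _) hb ?_
  simpa using tendsto_inv_oddAtTop.const_mul C

/-- The residual of the exact `v` in the limiting equation is `v / (2π)` times the midpoint error.
As `ω'` is odd, the two ends add up to `-(v / (2π)) (s² / 12) ω'(π / v)`, with `s = 2π / (v L)`. -/
theorem tendsto_sq_mul_leadingDefect (hlam : 0 ≤ lam) (hu : IsLeadingSolution lam u)
    (hD : ∀ L, Odd L → IsHighestEnergy L lam (D L)) :
    Tendsto (fun L : ℕ => (L : ℝ) ^ 2 * leadingDefect lam (D L / L + 1 / 2)) oddAtTop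
      (𝓝 (-(π / (6 * u)) * deriv (angleEnergy lam) (π / u))) := by
  obtain ⟨C, hC0, hC⟩ := exists_midpointSum_second_order (contDiff_angleEnergy hlam)
    (hasDerivAt_energyIntegral lam) (π / 2)
  have hodd : ∀ w, deriv (angleEnergy lam) (-w) = -deriv (angleEnergy lam) w := by
    intro w
    rw [deriv_angleEnergy hlam, deriv_angleEnergy hlam, angleEnergy_neg, mul_neg, sin_neg]
    ring
  have hv := tendsto_scaled_energy hlam hu hD
  have hmain : Tendsto (fun L : ℕ => -(π / (6 * (D L / L + 1 / 2))) *
      deriv (angleEnergy lam) (π / (D L / L + 1 / 2))) oddAtTop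
      (𝓝 (-(π / (6 * u)) * deriv (angleEnergy lam) (π / u))) := by
    have hu0 := hu.1
    have hcont : Continuous (deriv (angleEnergy lam)) :=
      (contDiff_angleEnergy hlam (n := ∞)).deriv_of_infty.continuous
    have h1 : Tendsto (fun L : ℕ => π / (D L / L + 1 / 2)) oddAtTop (𝓝 (π / u)) :=
      tendsto_const_nhds.div hv hu0
    exact (tendsto_const_nhds.div (hv.const_mul 6) (by simpa using hu0)).neg.mul
      ((hcont.tendsto _).comp h1)
  refine tendsto_of_tendsto_of_dist hmain ?_
  have hb : ∀ᶠ L : ℕ in oddAtTop, dist (-(π / (6 * (D L / L + 1 / 2))) *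
      deriv (angleEnergy lam) (π / (D L / L + 1 / 2)))
      ((L : ℝ) ^ 2 * leadingDefect lam (D L / L + 1 / 2)) ≤ C * π ^ 2 * (1 / L) := by
    filter_upwards [eventually_scaled hlam hD] with L ⟨hL0, hv, m, s, hs, hs1, hs2, hs3, hb, hb2, he⟩
    set v := D L / L + 1 / 2
    have h1 := hC m s hs hs1 hb2
    rw [hb, hodd] at h1
    have hv0 : 0 < v := by linarith
    have hpi := pi_pos
    have hsq : v / (2 * π) * (s ^ 2 / 24) * 2 * (L : ℝ) ^ 2 = π / (6 * v) := by
      rw [hs2]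
      field_simp
      norm_num
    set G := deriv (angleEnergy lam) (π / v)
    set P := energyIntegral lam (π / v) - energyIntegral lam (-(π / v)) with hP
    have hdef : leadingDefect lam v = v - (1 + v / (2 * π) * P) := leadingDefect_eq lam v
    have hdist : -(π / (6 * v)) * G - (L : ℝ) ^ 2 * leadingDefect lam v =
        -((L : ℝ) ^ 2 * (v / (2 * π)) *
          (midpointSum (angleEnergy lam) m s - (P - s ^ 2 / 24 * (G - -G)))) := by
      rw [hdef, ← hsq]
      linear_combination -(L : ℝ) ^ 2 * he
    rw [Real.dist_eq, hdist, abs_neg, abs_mul, abs_of_pos (by positivity)]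
    calc (L : ℝ) ^ 2 * (v / (2 * π)) *
          |midpointSum (angleEnergy lam) m s - (P - s ^ 2 / 24 * (G - -G))|
        ≤ (L : ℝ) ^ 2 * (v / (2 * π)) * (C * s ^ 3) := by gcongr
      _ = C * L * s ^ 2 * (L * (v / (2 * π)) * s) := by ring
      _ = C * L * s ^ 2 := by
        have : (L : ℝ) * (v / (2 * π)) * s = 1 := by
          rw [hs2]
          field_simp
        rw [this, mul_one]
      _ ≤ C * L * (π * (1 / L)) ^ 2 := by gcongr
      _ = C * π ^ 2 * (1 / L) := by field_simp
  refine squeeze_zero' (Eventually.of_forall fun _ => dist_nonneg) hb ?_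
  simpa using tendsto_inv_oddAtTop.const_mul (C * π ^ 2)

theorem tendsto_sq_mul_sub (hlam : 0 ≤ lam) (hu : IsLeadingSolution lam u)
    (hD : ∀ L, Odd L → IsHighestEnergy L lam (D L)) :
    Tendsto (fun L : ℕ => (L : ℝ) ^ 2 * (D L / L + 1 / 2 - u)) oddAtTop (𝓝 (zTwo lam u)) := by
  have hder := hu.hasDerivAt_leadingDefect
  have hu0 : 0 < u := by linarith [hu.two_le hlam]
  have hS : 0 < angleEnergy lam (π / u) := by linarith [one_le_angleEnergy hlam (π / u)]
  -- The factorisation of the defect as `(v - u)` times `dslope` also holds when `v = u`, so no case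
  -- distinction is needed.
  have hslope : Tendsto (fun L : ℕ => dslope (leadingDefect lam) u (D L / L + 1 / 2)) oddAtTop
      (𝓝 ((1 + angleEnergy lam (π / u)) / u)) := by
    have h1 : ContinuousAt (dslope (leadingDefect lam) u) u :=
      continuousAt_dslope_same.2 hder.differentiableAt
    have h2 := h1.tendsto.comp (tendsto_scaled_energy hlam hu hD)
    rwa [dslope_same, hder.deriv] at h2
  have hne : (1 + angleEnergy lam (π / u)) / u ≠ 0 := by positivity
  have hlim := (tendsto_sq_mul_leadingDefect hlam hu hD).div hslope hne
  have hz : -(π / (6 * u)) * deriv (angleEnergy lam) (π / u) /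
      ((1 + angleEnergy lam (π / u)) / u) = zTwo lam u := by
    have hpi := pi_ne_zero
    rw [deriv_angleEnergy hlam, zTwo, mul_div_assoc' 2 π u]
    change _ = -(lam / (12 * π)) * sin (2 * π / u) *
      (1 / (angleEnergy lam (π / u) * (1 + angleEnergy lam (π / u))))
    field_simp
    ring
  rw [hz] at hlim
  refine hlim.congr' ?_
  filter_upwards [hslope.eventually_ne hne] with L hL
  simp only [Pi.div_apply]
  rw [div_eq_iff hL]
  have := sub_smul_dslope (leadingDefect lam) u (D L / L + 1 / 2)
  rw [hu.leadingDefect_eq_zero, sub_zero, smul_eq_mul] at this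
  rw [← this]
  ring

theorem exists_expansion_of_order (hlam : 0 ≤ lam) (hu : IsLeadingSolution lam u)
    (hD : ∀ L, Odd L → IsHighestEnergy L lam (D L)) (N : ℕ) :
    ∃ c : ℕ → ℝ, (fun L : ℕ => D L / L + 1 / 2 - ∑ n ∈ Finset.range N, c n * (1 / (L : ℝ)) ^ n)
      =O[oddAtTop] fun L : ℕ => (1 / (L : ℝ)) ^ N := by
  have hε := tendsto_inv_oddAtTop
  have hv := tendsto_scaled_energy hlam hu hD
  have hu2 := hu.two_le hlam
  have hu0 : u ≠ 0 := hu.1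
  have hpi := pi_pos
  -- The order is `N + 1` because order 0 would neither determine `Φ (b, 0)` nor make the residual
  -- tend to 0; the surplus order is dropped at the end.
  obtain ⟨Φ, hΦ, hΦ0, C, hC0, hC⟩ := exists_smooth_midpointSum_approx (N + 1)
    (contDiff_angleEnergy hlam) (hasDerivAt_energyIntegral lam) (π / 2)
  -- The Bethe equation with `1/L` replaced by a continuous variable and the midpoint sum by its
  -- smooth approximation.
  set f : ℝ × ℝ → ℝ :=
    fun p => p.2 - (1 + p.2 / (2 * π) * Φ (π / p.2, 2 * π / p.2 * p.1)) with hf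
  have hf0 : ∀ v, f (0, v) = leadingDefect lam v := by
    intro v
    simp only [hf, mul_zero]
    rw [hΦ0 (Nat.succ_pos N), leadingDefect_eq]
  have hfs : ContDiffAt ℝ ∞ f (0, u) := by
    have h1 : ContDiffAt ℝ ∞ (fun p : ℝ × ℝ => (π / p.2, 2 * π / p.2 * p.1)) (0, u) :=
      (contDiffAt_const.div contDiffAt_snd hu0).prodMk
        ((contDiffAt_const.div contDiffAt_snd hu0).mul contDiffAt_fst)
    have h2 : ContDiffAt ℝ ∞ (fun p : ℝ × ℝ => Φ (π / p.2, 2 * π / p.2 * p.1)) (0, u) :=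
      hΦ.contDiffAt.comp _ h1
    exact contDiffAt_snd.sub (contDiffAt_const.add ((contDiffAt_snd.div_const _).mul h2))
  have hfd : HasDerivAt (fun v => f (0, v)) ((1 + angleEnergy lam (π / u)) / u) u := by
    simp only [hf0]
    exact hu.hasDerivAt_leadingDefect
  have hne : (1 + angleEnergy lam (π / u)) / u ≠ 0 := by
    have : 0 < angleEnergy lam (π / u) := by linarith [one_le_angleEnergy hlam (π / u)]
    positivity
  have hO : (fun L : ℕ => f (1 / (L : ℝ), D L / L + 1 / 2)) =O[oddAtTop]
      fun L : ℕ => (1 / (L : ℝ)) ^ (N + 1) := by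
    have hvO := (hv.div_const (2 * π)).isBigO_one ℝ
    have hsO : (fun L : ℕ => f (1 / (L : ℝ), D L / L + 1 / 2)) =O[oddAtTop]
        fun L : ℕ => (D L / L + 1 / 2) / (2 * π) * (1 / (L : ℝ)) ^ (N + 1) := by
      refine IsBigO.of_bound (C * π ^ (N + 1)) ?_
      filter_upwards [eventually_scaled hlam hD] with
        L ⟨hL0, hv, m, s, hs, hs1, hs2, hs3, hb, hb2, he⟩
      set v := D L / L + 1 / 2
      have h1 := hC m s hs hs1 hb2
      rw [hb] at h1
      have hv0 : 0 < v := by linarith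
      have h2 : f (1 / (L : ℝ), v) =
          v / (2 * π) * (midpointSum (angleEnergy lam) m s - Φ (π / v, s)) := by
        simp only [hf]
        rw [← hs2]
        linear_combination he
      rw [h2, norm_mul, norm_mul, Real.norm_of_nonneg (by positivity : 0 ≤ v / (2 * π)),
        Real.norm_eq_abs, Real.norm_of_nonneg (by positivity : 0 ≤ (1 / (L : ℝ)) ^ (N + 1))]
      calc v / (2 * π) * |midpointSum (angleEnergy lam) m s - Φ (π / v, s)|
          ≤ v / (2 * π) * (C * (π * (1 / L)) ^ (N + 1)) := by
            gcongr
            exact h1.trans (by gcongr)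
        _ = _ := by rw [mul_pow]; ring
    refine hsO.trans ?_
    simpa using hvO.mul (isBigO_refl (fun L : ℕ => (1 / (L : ℝ)) ^ (N + 1)) oddAtTop)
  have hg : Tendsto (fun L : ℕ => (1 / (L : ℝ)) ^ (N + 1)) oddAtTop (𝓝 0) := by
    simpa using hε.pow (N + 1)
  obtain ⟨V, hV, hVO⟩ := exists_contDiffAt_approx_of_implicit hfs
    (by rw [hf0, hu.leadingDefect_eq_zero]) hfd hne hε hv hg hO
  obtain ⟨c, hc⟩ := exists_taylor_coeff hV (N + 1)
  refine ⟨c, isBigO_sub_sum_of_le hε (Nat.le_succ N) ?_⟩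
  refine (hVO.add (hc.comp_tendsto hε)).congr_left fun L => ?_
  simp only [Function.comp_apply]
  ring

theorem exists_hasInvLExpansion (hlam : 0 ≤ lam) (hu : IsLeadingSolution lam u)
    (hD : ∀ L, Odd L → IsHighestEnergy L lam (D L)) :
    ∃ z : ℕ → ℝ, z 0 = u - 1 / 2 ∧ z 1 = 0 ∧ z 2 = zTwo lam u ∧ HasInvLExpansion D z := by
  have hε := tendsto_inv_oddAtTop
  have hL0 : ∀ᶠ L : ℕ in oddAtTop, (L : ℝ) ≠ 0 := by
    filter_upwards [eventually_ge_oddAtTop 1] with L hL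
    positivity
  have hne : ∀ᶠ L : ℕ in oddAtTop, 1 / (L : ℝ) ≠ 0 := by
    filter_upwards [hL0] with L hL
    exact one_div_ne_zero hL
  obtain ⟨c, hc⟩ := exists_coeff_of_forall_order hε hne (exists_expansion_of_order hlam hu hD)
  have hrem : ∀ N : ℕ, Tendsto (fun L : ℕ => (L : ℝ) ^ N * (D L / L + 1 / 2 -
      ∑ n ∈ Finset.range (N + 1), c n * (1 / (L : ℝ)) ^ n)) oddAtTop (𝓝 0) := by
    intro N
    refine ((isBigO_refl (fun L : ℕ => (L : ℝ) ^ N) oddAtTop).mul (hc (N + 1))).trans_tendsto ?_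
    refine hε.congr' ?_
    filter_upwards [hL0] with L hL
    rw [pow_succ, ← mul_assoc, ← mul_pow, mul_one_div_cancel hL, one_pow, one_mul]
  have h2 := tendsto_sq_mul_sub hlam hu hD
  have hc0 : c 0 = u := by
    have h := (tendsto_scaled_energy hlam hu hD).sub (hrem 0)
    rw [sub_zero] at h
    exact tendsto_nhds_unique (by simp) h
  have hc1 : c 1 = 0 := by
    have h := (h2.mul hε).sub (hrem 1)
    rw [mul_zero, sub_zero] at h
    refine tendsto_nhds_unique (tendsto_const_nhds.congr' ?_) h
    filter_upwards [hL0] with L hL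
    simp only [Finset.sum_range_succ, Finset.sum_range_zero, hc0]
    field_simp
    ring
  have hc2 : c 2 = zTwo lam u := by
    have h := h2.sub (hrem 2)
    rw [sub_zero] at h
    refine tendsto_nhds_unique (tendsto_const_nhds.congr' ?_) h
    filter_upwards [hL0] with L hL
    simp only [Finset.sum_range_succ, Finset.sum_range_zero, hc0, hc1]
    field_simp
    ring
  -- The coefficients `c` belong to `Δ / L + 1 / 2`, so only the zeroth one is shifted.
  -- Multiplication by `L` then costs one order of the error.
  refine ⟨fun n => if n = 0 then u - 1 / 2 else c n, by simp, by simpa using hc1,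
    by simpa using hc2, fun N => ?_⟩
  have h := (isBigO_refl (fun L : ℕ => (L : ℝ)) oddAtTop).mul (hc (N + 1))
  refine h.congr' ?_ ?_
  · filter_upwards [hL0] with L hL
    rw [Finset.sum_range_succ', Finset.sum_range_succ', hc0]
    simp only [Nat.succ_ne_zero, if_false, if_true, pow_zero, mul_one, div_one, div_pow, one_pow,
      mul_one_div]
    field_simp
    ring
  · filter_upwards [hL0] with L hL
    rw [pow_succ, mul_comm, mul_assoc, one_div_mul_cancel hL, mul_one, one_div_pow]

end FixedCoupling

/-! ### Strong coupling: pointwise estimates and the common quadratic equation -/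

/-- Two-term comparison of `√(1 + r² sin² θ)` with `√(1 + r² θ²)`, uniform in `r`. -/
theorem abs_sqrt_sin_sub_le {r θ : ℝ} (hr : 0 ≤ r) (h0 : 0 ≤ θ) (h1 : θ ≤ 1) :
    |√(1 + r ^ 2 * sin θ ^ 2) - (√(1 + r ^ 2 * θ ^ 2) - r * θ ^ 3 / 6)| ≤
      θ ^ 2 + r * θ ^ 5 := by
  rcases h0.eq_or_lt with rfl | hpos
  · simp
  set s := sin θ with hs
  have hsle : s ≤ θ := (sin_lt hpos).le
  have hsge : θ - θ ^ 3 / 6 ≤ s := sin_ge_sub_cube h0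
  have hsb : s ≤ θ - θ ^ 3 / 6 + θ ^ 5 / 100 := by
    have := Real.sin_bound (x := θ) (by rwa [abs_of_pos hpos])
    rw [abs_of_pos hpos] at this
    linarith [(abs_le.1 this).2]
  have hs0 : 0 ≤ s := by
    have : θ ^ 3 ≤ θ := by
      calc θ ^ 3 = θ * θ ^ 2 := by ring
        _ ≤ θ * 1 := by gcongr; exact pow_le_one₀ h0 h1
        _ = θ := mul_one θ
    linarith
  set P := √(1 + r ^ 2 * θ ^ 2) with hP
  set Q := √(1 + r ^ 2 * s ^ 2) with hQ
  have hP2 : P ^ 2 = 1 + r ^ 2 * θ ^ 2 := Real.sq_sqrt (by positivity)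
  have hQ2 : Q ^ 2 = 1 + r ^ 2 * s ^ 2 := Real.sq_sqrt (by positivity)
  have hrθ : 0 ≤ r * θ := by positivity
  have hrs : 0 ≤ r * s := by positivity
  have hPl : r * θ ≤ P := Real.le_sqrt_of_sq_le (by nlinarith)
  have hPu : P ≤ 1 + r * θ := Real.sqrt_le_iff.2 ⟨by positivity, by nlinarith⟩
  have hQl : r * s ≤ Q := Real.le_sqrt_of_sq_le (by nlinarith)
  have hQu : Q ≤ 1 + r * s := Real.sqrt_le_iff.2 ⟨by positivity, by nlinarith⟩
  have hP1 : 1 ≤ P := Real.one_le_sqrt.2 (by nlinarith)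
  have hQ1 : 1 ≤ Q := Real.one_le_sqrt.2 (by nlinarith)
  -- The sum `P + Q` lies between `r (θ + s)` and `2 + r (θ + s)`. Dividing by it pins `P - Q`
  -- between `r (θ - s) - θ² / 3` and `r (θ - s)`, and `θ - s` is `θ³ / 6` up to `θ⁵`.
  have hprod : (P - Q) * (P + Q) = r * (θ - s) * (r * (θ + s)) := by nlinarith
  have hd0 : 0 ≤ r * (θ - s) := mul_nonneg hr (by linarith)
  have hupper : P - Q ≤ r * (θ - s) := by
    by_contra hcon
    push Not at hcon
    nlinarith
  have hlower : r * (θ - s) - θ ^ 2 / 3 ≤ P - Q := by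
    have hA : r * (θ - s) * (r * (θ + s)) ≤ (P - Q) * (2 + r * (θ + s)) := by
      rw [← hprod]
      have : 0 ≤ P - Q := by
        by_contra hcon
        push Not at hcon
        nlinarith [mul_nonneg hd0 (by positivity : 0 ≤ r * (θ + s))]
      refine mul_le_mul_of_nonneg_left ?_ this
      have : r * (θ + s) = r * θ + r * s := by ring
      linarith
    have hB : 0 < 2 + r * (θ + s) := by positivity
    have hC : 2 * r * (θ - s) ≤ θ ^ 2 / 3 * (2 + r * (θ + s)) := by
      have h2 : θ - s ≤ θ ^ 3 / 6 := by linarith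
      calc 2 * r * (θ - s) ≤ 2 * r * (θ ^ 3 / 6) := by gcongr
        _ = θ ^ 2 / 3 * (r * θ) := by ring
        _ ≤ θ ^ 2 / 3 * (2 + r * (θ + s)) := by
          gcongr
          nlinarith
    by_contra hcon
    push Not at hcon
    nlinarith
  have h5 : 0 ≤ r * θ ^ 5 := by positivity
  have h6 : r * (θ ^ 3 / 6 - θ ^ 5 / 100) ≤ r * (θ - s) :=
    mul_le_mul_of_nonneg_left (by linarith) hr
  have h7 : r * (θ - s) ≤ r * (θ ^ 3 / 6) := mul_le_mul_of_nonneg_left (by linarith) hr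
  rw [abs_le]
  constructor <;> nlinarith [sq_nonneg θ]

theorem angleEnergy_pow_four {μ : ℝ} (t x : ℝ) :
    angleEnergy (μ ^ 4) (π / x * t) =
      √(1 + (μ ^ 2 / π) ^ 2 * sin (π / x * t) ^ 2) := by
  rw [angleEnergy]
  ring_nf

/-- With `r = μ² / π` and `θ = π t / x` the product `r θ` is `(μ² / x) t`. For `x` of size `μ` this
is large while `θ` is small. -/
theorem abs_angleEnergy_sub_le {μ t x : ℝ} (ht : 0 ≤ t) (hx : 0 < x)
    (htx : π / x * t ≤ 1) :
    |angleEnergy (μ ^ 4) (π / x * t) -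
      (√(1 + (μ ^ 2 / x * t) ^ 2) - π ^ 2 * μ ^ 2 / (6 * x ^ 3) * t ^ 3)| ≤
      (π / x * t) ^ 2 + π ^ 4 * μ ^ 2 / x ^ 5 * t ^ 5 := by
  have hpi := pi_pos
  have h := abs_sqrt_sin_sub_le (r := μ ^ 2 / π) (θ := π / x * t) (by positivity) (by positivity)
    htx
  have e1 : (μ ^ 2 / π) ^ 2 * (π / x * t) ^ 2 = (μ ^ 2 / x * t) ^ 2 := by field_simp
  have e2 : μ ^ 2 / π * (π / x * t) ^ 3 / 6 = π ^ 2 * μ ^ 2 / (6 * x ^ 3) * t ^ 3 := by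
    field_simp
  have e3 : μ ^ 2 / π * (π / x * t) ^ 5 = π ^ 4 * μ ^ 2 / x ^ 5 * t ^ 5 := by field_simp
  rw [e1, e2, e3] at h
  rwa [angleEnergy_pow_four]

/-- Together with `le_angleEnergy_pow_four` (Jordan's inequality), this crude bound places the
unknowns between constant multiples of `μ` before any expansion is made. -/
theorem angleEnergy_pow_four_le {μ t x : ℝ} (ht : 0 ≤ t) (hx : 0 < x) :
    angleEnergy (μ ^ 4) (π / x * t) ≤ 1 + μ ^ 2 / x * t := by
  have hpi := pi_pos
  rw [angleEnergy_pow_four, Real.sqrt_le_iff]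
  refine ⟨by positivity, ?_⟩
  have h1 : sin (π / x * t) ^ 2 ≤ (π / x * t) ^ 2 :=
    sq_le_sq.2 abs_sin_le_abs
  calc 1 + (μ ^ 2 / π) ^ 2 * sin (π / x * t) ^ 2
      ≤ 1 + (μ ^ 2 / π) ^ 2 * (π / x * t) ^ 2 := by gcongr
    _ = 1 + (μ ^ 2 / x * t) ^ 2 := by field_simp
    _ ≤ (1 + μ ^ 2 / x * t) ^ 2 := by
      have : 0 ≤ μ ^ 2 / x * t := by positivity
      nlinarith

theorem le_angleEnergy_pow_four {μ t x : ℝ} (ht : 0 ≤ t) (hx : 0 < x)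
    (htx : π / x * t ≤ π / 2) :
    2 / π * (μ ^ 2 / x * t) ≤ angleEnergy (μ ^ 4) (π / x * t) := by
  have hpi := pi_pos
  have h0 : 0 ≤ π / x * t := by positivity
  rw [angleEnergy_pow_four]
  apply Real.le_sqrt_of_sq_le
  have h1 := mul_le_sin h0 htx
  calc (2 / π * (μ ^ 2 / x * t)) ^ 2 = (μ ^ 2 / π) ^ 2 * (2 / π * (π / x * t)) ^ 2 := by
        field_simp
    _ ≤ (μ ^ 2 / π) ^ 2 * sin (π / x * t) ^ 2 := by gcongr
    _ ≤ _ := by linarith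

theorem abs_sqrt_one_add_sq_sub_le {y : ℝ} (hy : 0 < y) :
    |√(1 + y ^ 2) - (y + 1 / (2 * y))| ≤ 1 / (8 * y ^ 3) := by
  have hS2 : √(1 + y ^ 2) ^ 2 = 1 + y ^ 2 := Real.sq_sqrt (by positivity)
  have hSy : y ≤ √(1 + y ^ 2) := Real.le_sqrt_of_sq_le (by linarith)
  set S := √(1 + y ^ 2)
  have hid : S - (y + 1 / (2 * y)) = -(1 / (4 * y ^ 2)) / (S + (y + 1 / (2 * y))) := by
    have : 0 < S + (y + 1 / (2 * y)) := by positivity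
    rw [eq_div_iff this.ne']
    have : (S - (y + 1 / (2 * y))) * (S + (y + 1 / (2 * y))) =
      S ^ 2 - (y + 1 / (2 * y)) ^ 2 := by ring
    rw [this, hS2]
    field_simp
    ring
  have hpos : 0 < S + (y + 1 / (2 * y)) := by positivity
  rw [hid, abs_div, abs_neg, abs_of_pos (by positivity), abs_of_pos hpos,
    div_le_iff₀ hpos]
  have : 2 * y ≤ S + (y + 1 / (2 * y)) := by
    have : 0 < 1 / (2 * y) := by positivity
    linarith
  calc 1 / (4 * y ^ 2) = 1 / (8 * y ^ 3) * (2 * y) := by field_simp; norm_num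
    _ ≤ _ := by gcongr

theorem integral_sqrt_one_add_sq {q : ℝ} (hq : 0 < q) :
    ∫ t in (0 : ℝ)..1, √(1 + (q * t) ^ 2) = √(1 + q ^ 2) / 2 + arsinh q / (2 * q) := by
  have hder : ∀ t : ℝ, HasDerivAt (fun t => t * √(1 + (q * t) ^ 2) / 2 + arsinh (q * t) / (2 * q))
      (√(1 + (q * t) ^ 2)) t := by
    intro t
    have hp : 0 < 1 + (q * t) ^ 2 := by positivity
    have h1 : HasDerivAt (fun t : ℝ => q * t) q t := by
      simpa using (hasDerivAt_id t).const_mul q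
    have h2 : HasDerivAt (fun t : ℝ => 1 + (q * t) ^ 2) (2 * (q * t) * q) t := by
      simpa using (h1.pow 2).const_add 1
    have h3 := h2.sqrt hp.ne'
    have h4 := (((hasDerivAt_id t).mul h3).div_const 2).add (h1.arsinh.div_const (2 * q))
    refine h4.congr_deriv ?_
    have hS2 : √(1 + (q * t) ^ 2) ^ 2 = 1 + (q * t) ^ 2 := Real.sq_sqrt hp.le
    have hS0 : √(1 + (q * t) ^ 2) ≠ 0 := (Real.sqrt_pos.2 hp).ne'
    simp only [id, smul_eq_mul]
    generalize √(1 + (q * t) ^ 2) = S at hS2 hS0 ⊢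
    field_simp
    nlinarith
  rw [intervalIntegral.integral_eq_sub_of_hasDerivAt (fun t _ => hder t)
    ((by fun_prop : Continuous fun t : ℝ => √(1 + (q * t) ^ 2)).intervalIntegrable 0 1)]
  simp

theorem abs_arsinh_sub_log_le {q : ℝ} (hq : 0 < q) :
    |arsinh q - log (2 * q)| ≤ 1 / (4 * q ^ 2) := by
  have hSl : q ≤ √(1 + q ^ 2) := Real.le_sqrt_of_sq_le (by linarith)
  have hSu : √(1 + q ^ 2) ≤ q + 1 / (2 * q) := by
    refine Real.sqrt_le_iff.2 ⟨by positivity, ?_⟩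
    have : (q + 1 / (2 * q)) ^ 2 = 1 + q ^ 2 + (1 / (2 * q)) ^ 2 := by
      field_simp
      ring
    rw [this]
    nlinarith [sq_nonneg (1 / (2 * q))]
  have h1 : log (2 * q) ≤ arsinh q := log_le_log (by positivity) (by linarith)
  have h2 : arsinh q ≤ log (2 * q) + 1 / (4 * q ^ 2) := by
    have h3 : arsinh q ≤ log (2 * q * (1 + 1 / (4 * q ^ 2))) := by
      apply log_le_log (by positivity)
      have : 2 * q * (1 + 1 / (4 * q ^ 2)) = q + (q + 1 / (2 * q)) := by
        field_simp
        ring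
      linarith
    rw [log_mul (by positivity) (by positivity)] at h3
    have h4 := log_le_sub_one_of_pos (by positivity : 0 < 1 + 1 / (4 * q ^ 2))
    linarith
  rw [abs_of_nonneg (by linarith)]
  linarith

/-- The `arsinh` in the exact integral is the source of `log λ` in the expansion of `u`. -/
theorem abs_integral_sqrt_sub_le {q : ℝ} (hq : 0 < q) :
    |(∫ t in (0 : ℝ)..1, √(1 + (q * t) ^ 2)) -
      (q / 2 + 1 / (4 * q) + log (2 * q) / (2 * q))| ≤ 1 / q ^ 3 := by
  rw [integral_sqrt_one_add_sq hq]
  have h1 := abs_sqrt_one_add_sq_sub_le hq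
  have h2 := abs_arsinh_sub_log_le hq
  have hid : √(1 + q ^ 2) / 2 + arsinh q / (2 * q) -
      (q / 2 + 1 / (4 * q) + log (2 * q) / (2 * q)) =
      1 / 2 * (√(1 + q ^ 2) - (q + 1 / (2 * q))) +
        1 / (2 * q) * (arsinh q - log (2 * q)) := by
    field_simp
    ring
  rw [hid]
  refine (abs_add_le _ _).trans ?_
  rw [abs_mul, abs_mul, abs_of_pos (by positivity : (0 : ℝ) < 1 / (2 * q)),
    abs_of_pos (by positivity : (0 : ℝ) < 1 / 2)]
  calc 1 / 2 * |√(1 + q ^ 2) - (q + 1 / (2 * q))| + 1 / (2 * q) * |arsinh q - log (2 * q)|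
      ≤ 1 / 2 * (1 / (8 * q ^ 3)) + 1 / (2 * q) * (1 / (4 * q ^ 2)) := by gcongr
    _ = 3 / 16 * (1 / q ^ 3) := by
      field_simp
      norm_num
    _ ≤ 1 / q ^ 3 := by
      have : 0 < 1 / q ^ 3 := by positivity
      linarith

/-- Since `B = (y - kμ)(y + kμ)`, the error is exactly `-B² / (2kμ (y + kμ)²)`. -/
theorem abs_sub_sqrt_expansion_le {y k μ B : ℝ} (hk : 0 < k) (hμ : 0 < μ) (hy : 0 < y)
    (h : y ^ 2 = k ^ 2 * μ ^ 2 + B) :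
    |y - (k * μ + B / (2 * k * μ))| ≤ 1 / (2 * k ^ 3) * (B ^ 2 / μ ^ 3) := by
  have hB : B = (y - k * μ) * (y + k * μ) := by linear_combination -h
  have hs : 0 < y + k * μ := by positivity
  have hid : y - (k * μ + B / (2 * k * μ)) = -(B ^ 2 / (2 * k * μ * (y + k * μ) ^ 2)) := by
    rw [hB]
    field_simp
    ring
  rw [hid, abs_neg, abs_of_nonneg (by positivity)]
  calc B ^ 2 / (2 * k * μ * (y + k * μ) ^ 2) ≤ B ^ 2 / (2 * k * μ * (k * μ) ^ 2) := by
        gcongr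
        linarith
    _ = 1 / (2 * k ^ 3) * (B ^ 2 / μ ^ 3) := by field_simp

/-- The gauge `w` measures the size of `B`: it is `log` in the equation for `u` and constant at
fixed `L`. -/
theorem isBigO_sub_sqrt_expansion {y B B' w : ℝ → ℝ} {K : ℝ} (hK : 0 < K)
    (hy : ∀ᶠ μ in atTop, 0 < y μ) (h : ∀ᶠ μ in atTop, y μ ^ 2 = K * μ ^ 2 + B μ)
    (h1 : (fun μ => B μ - B' μ) =O[atTop] fun μ => w μ / μ)
    (h2 : (fun μ => B μ ^ 2) =O[atTop] fun μ => μ * w μ) :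
    (fun μ => y μ - (√K * μ + B' μ / (2 * √K * μ))) =O[atTop] fun μ => w μ / μ ^ 2 := by
  have hk : 0 < √K := Real.sqrt_pos.2 hK
  have hA : (fun μ => y μ - (√K * μ + B μ / (2 * √K * μ))) =O[atTop] fun μ => w μ / μ ^ 2 := by
    have h3 : (fun μ => y μ - (√K * μ + B μ / (2 * √K * μ))) =O[atTop]
        fun μ => B μ ^ 2 / μ ^ 3 := by
      refine IsBigO.of_bound (1 / (2 * √K ^ 3)) ?_
      filter_upwards [hy, h, eventually_gt_atTop 0] with μ h1 h2 hμ
      rw [Real.norm_eq_abs, Real.norm_of_nonneg (by positivity)]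
      refine abs_sub_sqrt_expansion_le hk hμ h1 ?_
      rw [Real.sq_sqrt hK.le, h2]
    refine h3.trans ?_
    have h4 := h2.mul (isBigO_refl (fun μ : ℝ => 1 / μ ^ 3) atTop)
    refine h4.congr' (Eventually.of_forall fun μ => by ring) ?_
    filter_upwards [eventually_gt_atTop 0] with μ hμ
    field_simp
  have hB : (fun μ => (B μ - B' μ) / (2 * √K * μ)) =O[atTop] fun μ => w μ / μ ^ 2 := by
    have h4 := (h1.mul (isBigO_refl (fun μ : ℝ => 1 / μ) atTop)).const_mul_left (1 / (2 * √K))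
    refine h4.congr (fun μ => ?_) (fun μ => ?_)
    · rw [mul_one_div, div_mul_eq_div_div, ← mul_one_div (B μ - B' μ)]
      ring
    · ring
  refine (hA.add hB).congr_left fun μ => ?_
  ring

/-- Large `μ` expansion of a solution `X ≍ μ` of
`X² - c X = K μ² + α ρ + h ρ + O(1 / μ)`, `ρ = (X / μ)²`. -/
theorem isBigO_sub_quadratic_expansion {X α w h : ℝ → ℝ} {c K a b : ℝ} (hK : 0 < K) (ha : 0 < a)
    (hX : ∀ᶠ μ in atTop, a * μ ≤ X μ ∧ X μ ≤ b * μ)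
    (hh : ContinuousOn h (Set.Icc (a ^ 2) (b ^ 2))) (hhK : DifferentiableAt ℝ h K)
    (hw1 : (fun _ => (1 : ℝ)) =O[atTop] w) (hwμ : w =O[atTop] fun μ => μ)
    (hα : α =O[atTop] w)
    (heq : (fun μ => X μ ^ 2 - c * X μ - K * μ ^ 2 -
      (α μ * (X μ / μ) ^ 2 + h ((X μ / μ) ^ 2))) =O[atTop] fun μ => 1 / μ) :
    (fun μ => X μ - c / 2 - (√K * μ + (c ^ 2 / 4 + α μ * K + h K) / (2 * √K * μ)))
      =O[atTop] fun μ => w μ / μ ^ 2 := by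
  set ρ : ℝ → ℝ := fun μ => (X μ / μ) ^ 2 with hρ
  have hone : (fun μ : ℝ => 1 / μ) =O[atTop] fun _ => (1 : ℝ) := by
    simpa [Pi.inv_def] using (tendsto_inv_atTop_zero (𝕜 := ℝ)).isBigO_one ℝ
  have hwdiv : (fun μ : ℝ => 1 / μ) =O[atTop] fun μ => w μ / μ := by
    simpa [div_eq_mul_inv] using hw1.mul (isBigO_refl (fun μ : ℝ => 1 / μ) atTop)
  have hρmem : ∀ᶠ μ in atTop, ρ μ ∈ Set.Icc (a ^ 2) (b ^ 2) := by
    filter_upwards [hX, eventually_gt_atTop 0] with μ ⟨h1, h2⟩ hμ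
    have h3 : a ≤ X μ / μ := by rwa [le_div_iff₀ hμ]
    have h4 : X μ / μ ≤ b := by rwa [div_le_iff₀ hμ]
    exact ⟨by simp only [hρ]; gcongr, by
      have : 0 ≤ X μ / μ := ha.le.trans h3
      simp only [hρ]; gcongr⟩
  have hρ1 : ρ =O[atTop] fun _ => (1 : ℝ) := by
    refine IsBigO.of_bound (b ^ 2) ?_
    filter_upwards [hρmem] with μ hμ
    rw [Real.norm_of_nonneg (by positivity), norm_one, mul_one]
    exact hμ.2
  have hhρ : (fun μ => h (ρ μ)) =O[atTop] fun _ => (1 : ℝ) := by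
    obtain ⟨C, hC⟩ := isCompact_Icc.exists_bound_of_continuousOn hh
    refine IsBigO.of_bound C ?_
    filter_upwards [hρmem] with μ hμ
    simpa using hC _ hμ
  have hXO : X =O[atTop] fun μ => μ := by
    refine IsBigO.of_bound b ?_
    filter_upwards [hX, eventually_gt_atTop 0] with μ ⟨h1, h2⟩ hμ
    rw [Real.norm_of_nonneg (by nlinarith), Real.norm_of_nonneg hμ.le]
    exact h2
  have hαρ : (fun μ => α μ * ρ μ) =O[atTop] w := by
    simpa using hα.mul hρ1
  have h1μ : (fun _ => (1 : ℝ)) =O[atTop] fun μ : ℝ => μ := hw1.trans hwμ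
  -- Bootstrap: the crude size of `X` already forces `ρ = K + O(1 / μ)`, which allows `ρ` to be
  -- replaced by `K` in the terms of lower order.
  have hsmall : (fun μ => ρ μ - K) =O[atTop] fun μ => 1 / μ := by
    have h1 : (fun μ => X μ ^ 2 - K * μ ^ 2) =O[atTop] fun μ : ℝ => μ := by
      have h2 := ((heq.trans (hone.trans h1μ)).add
        ((hαρ.trans hwμ).add (hhρ.trans h1μ))).add (hXO.const_mul_left c)
      refine h2.congr_left fun μ => ?_
      simp only [hρ]
      ring
    have h3 := h1.mul (isBigO_refl (fun μ : ℝ => 1 / μ ^ 2) atTop)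
    refine h3.congr' ?_ ?_
    · filter_upwards [eventually_gt_atTop 0] with μ hμ
      simp only [hρ]
      field_simp
    · filter_upwards [eventually_gt_atTop 0] with μ hμ
      field_simp
  have hρt : Tendsto ρ atTop (𝓝 K) := by
    have h1 : Tendsto (fun μ : ℝ => 1 / μ) atTop (𝓝 0) := by
      simpa using tendsto_inv_atTop_zero (𝕜 := ℝ)
    have h2 := (hsmall.trans_tendsto h1).add_const K
    simpa using h2
  have hhdiff : (fun μ => h (ρ μ) - h K) =O[atTop] fun μ => 1 / μ :=
    (hhK.hasDerivAt.isBigO_sub.comp_tendsto hρt).trans hsmall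
  -- Completing the square in `X² - c X` produces the shift `c / 2` and the constant `c² / 4`.
  have hBB : (fun μ => (X μ - c / 2) ^ 2 - K * μ ^ 2 - (c ^ 2 / 4 + α μ * K + h K))
      =O[atTop] fun μ => w μ / μ := by
    have h1 : (fun μ => α μ * (ρ μ - K)) =O[atTop] fun μ => w μ / μ := by
      simpa [div_eq_mul_inv] using hα.mul hsmall
    have h2 := (heq.trans hwdiv).add (h1.add (hhdiff.trans hwdiv))
    refine h2.congr_left fun μ => ?_
    simp only [hρ]
    ring
  refine isBigO_sub_sqrt_expansion hK (B := fun μ => (X μ - c / 2) ^ 2 - K * μ ^ 2) ?_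
    (Eventually.of_forall fun μ => by ring) hBB ?_
  · filter_upwards [hX, eventually_gt_atTop (c / 2 / a)] with μ ⟨h1, _⟩ h2
    rw [div_lt_iff₀ ha] at h2
    linarith
  · have hB' : (fun μ => c ^ 2 / 4 + α μ * K + h K) =O[atTop] w := by
      have h1 : (fun μ => α μ * K) =O[atTop] w := by
        simpa [mul_comm] using hα.const_mul_left K
      have hc : ∀ d : ℝ, (fun _ : ℝ => d) =O[atTop] w := fun d =>
        (isBigO_const_const d one_ne_zero atTop).trans hw1
      exact ((hc _).add h1).add (hc _)
    have hwd : (fun μ => w μ / μ) =O[atTop] w := by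
      simpa [div_eq_mul_inv] using (isBigO_refl w atTop).mul hone
    have hB : (fun μ => (X μ - c / 2) ^ 2 - K * μ ^ 2) =O[atTop] w := by
      refine ((hBB.trans hwd).add hB').congr_left fun μ => ?_
      ring
    refine ((hB.trans hwμ).mul hB).congr_left fun μ => ?_
    ring

/-! ### The leading-order equation at strong coupling -/

theorem integral_linear (c : ℝ) : ∫ t in (0 : ℝ)..1, c * t = c / 2 := by
  rw [intervalIntegral.integral_const_mul, integral_id]
  ring

theorem IsLeadingSolution.bounds {μ u : ℝ} (hμ : 1 ≤ μ) (h : IsLeadingSolution (μ ^ 4) u) :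
    1 / 2 * μ ≤ u ∧ u ≤ 3 * μ := by
  have hu2 := h.two_le (by positivity)
  have hu0 : 0 < u := by linarith
  have heq := ((isLeadingSolution_iff _ u).1 h).2
  have hpi := pi_pos
  have hI := intervalIntegrable_angleEnergy (μ ^ 4) (π / u) 0 1
  have hlo : 2 / π * (μ ^ 2 / u) / 2 ≤ ∫ t in (0 : ℝ)..1, angleEnergy (μ ^ 4) (π / u * t) := by
    rw [← integral_linear]
    refine intervalIntegral.integral_mono_on zero_le_one
      ((by fun_prop : Continuous fun t : ℝ => 2 / π * (μ ^ 2 / u) * t).intervalIntegrable 0 1) hI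
      fun t ht => ?_
    have ht0 := ht.1
    have ht1 := ht.2
    have := le_angleEnergy_pow_four (μ := μ) ht.1 hu0 (by
      calc π / u * t ≤ π / 2 * 1 := by gcongr
        _ = π / 2 := mul_one _)
    rwa [← mul_assoc] at this
  have hhi : ∫ t in (0 : ℝ)..1, angleEnergy (μ ^ 4) (π / u * t) ≤ 1 + μ ^ 2 / u := by
    have := intervalIntegral.integral_mono_on zero_le_one hI
      (intervalIntegrable_const (c := 1 + μ ^ 2 / u)) fun t ht => by
        refine (angleEnergy_pow_four_le ht.1 hu0).trans ?_
        have : μ ^ 2 / u * t ≤ μ ^ 2 / u * 1 := by gcongr; exact ht.2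
        linarith
    simpa using this
  have hmul : μ ^ 2 / u * u = μ ^ 2 := div_mul_cancel₀ _ hu0.ne'
  set q := μ ^ 2 / u
  constructor
  · have h1 : q / π ≤ u := by
      have : 2 / π * q / 2 = q / π := by ring
      linarith
    rw [div_le_iff₀ hpi] at h1
    have h2 : μ ^ 2 ≤ 4 * u ^ 2 := by
      have := pi_le_four
      nlinarith
    nlinarith
  · by_contra hcon
    push Not at hcon
    nlinarith

/-- The pointwise approximation is integrated over `[0, 1]`. The condition `μ ≥ 8` gives `u ≥ 4 ≥
π`, so the angles are at most 1; the constants come from `u ≥ μ / 2` and `q ≥ μ / 3`. -/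
theorem IsLeadingSolution.strongCoupling_equation {μ u : ℝ} (hμ : 8 ≤ μ)
    (h : IsLeadingSolution (μ ^ 4) u) :
    |u - 1 - (μ ^ 2 / u / 2 + 1 / (4 * (μ ^ 2 / u)) +
      log (2 * (μ ^ 2 / u)) / (2 * (μ ^ 2 / u))) + π ^ 2 * μ ^ 2 / (24 * u ^ 3)| ≤
      (4 * π ^ 2 + 32 * π ^ 4 + 27) / μ ^ 2 := by
  obtain ⟨hlo, hhi⟩ := h.bounds (by linarith)
  have hμ0 : 0 < μ := by linarith
  have hu0 : 0 < u := by linarith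
  have hpi := pi_pos
  have heq := ((isLeadingSolution_iff _ u).1 h).2
  set q := μ ^ 2 / u with hq
  have hq0 : 0 < q := by positivity
  have hqlo : μ / 3 ≤ q := by
    rw [hq, div_le_div_iff₀ (by norm_num) hu0]
    nlinarith
  have hI := intervalIntegrable_angleEnergy (μ ^ 4) (π / u) 0 1
  have hS : IntervalIntegrable (fun t : ℝ => √(1 + (q * t) ^ 2)) MeasureTheory.volume 0 1 :=
    (by fun_prop : Continuous fun t : ℝ => √(1 + (q * t) ^ 2)).intervalIntegrable 0 1
  have hT : IntervalIntegrable (fun t : ℝ => π ^ 2 * μ ^ 2 / (6 * u ^ 3) * t ^ 3)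
      MeasureTheory.volume 0 1 := (by fun_prop : Continuous _).intervalIntegrable 0 1
  have hTint : ∫ t in (0 : ℝ)..1, π ^ 2 * μ ^ 2 / (6 * u ^ 3) * t ^ 3 =
      π ^ 2 * μ ^ 2 / (24 * u ^ 3) := by
    rw [intervalIntegral.integral_const_mul, integral_pow]
    field_simp
    norm_num
  have h1 : |(∫ t in (0 : ℝ)..1, angleEnergy (μ ^ 4) (π / u * t)) -
      ((∫ t in (0 : ℝ)..1, √(1 + (q * t) ^ 2)) - π ^ 2 * μ ^ 2 / (24 * u ^ 3))| ≤
      (π / u) ^ 2 + π ^ 4 * μ ^ 2 / u ^ 5 := by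
    rw [← hTint, ← intervalIntegral.integral_sub hS hT,
      ← intervalIntegral.integral_sub hI (hS.sub hT)]
    have := intervalIntegral.norm_integral_le_of_norm_le_const (a := 0) (b := 1)
      (f := fun t => angleEnergy (μ ^ 4) (π / u * t) -
        (√(1 + (q * t) ^ 2) - π ^ 2 * μ ^ 2 / (6 * u ^ 3) * t ^ 3))
      (C := (π / u) ^ 2 + π ^ 4 * μ ^ 2 / u ^ 5) fun t ht => by
        rw [Set.uIoc_of_le zero_le_one] at ht
        have ht0 : 0 ≤ t := ht.1.le
        have ht1 := ht.2
        have hle : π / u * t ≤ 1 := by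
          calc π / u * t ≤ π / u * 1 := by gcongr
            _ ≤ 1 := by
              rw [mul_one, div_le_one hu0]
              linarith [pi_le_four]
        refine (abs_angleEnergy_sub_le (μ := μ) ht0 hu0 hle).trans ?_
        have e1 : π / u * t ≤ π / u * 1 := by gcongr
        have e2 : t ^ 5 ≤ 1 := pow_le_one₀ ht0 ht1
        calc (π / u * t) ^ 2 + π ^ 4 * μ ^ 2 / u ^ 5 * t ^ 5
            ≤ (π / u * 1) ^ 2 + π ^ 4 * μ ^ 2 / u ^ 5 * 1 := by gcongr
          _ = _ := by ring
    simpa using this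
  have h2 := abs_integral_sqrt_sub_le hq0
  rw [← sub_eq_iff_eq_add'.2 heq] at h1
  have e1 : (π / u) ^ 2 ≤ 4 * π ^ 2 / μ ^ 2 := by
    calc (π / u) ^ 2 ≤ (π / (1 / 2 * μ)) ^ 2 := by gcongr
      _ = 4 * π ^ 2 / μ ^ 2 := by field_simp; norm_num
  have e2 : π ^ 4 * μ ^ 2 / u ^ 5 ≤ 32 * π ^ 4 / μ ^ 2 := by
    calc π ^ 4 * μ ^ 2 / u ^ 5 ≤ π ^ 4 * μ ^ 2 / (1 / 2 * μ) ^ 5 := by gcongr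
      _ = 32 * π ^ 4 / μ ^ 2 * (1 / μ) := by field_simp; norm_num
      _ ≤ 32 * π ^ 4 / μ ^ 2 * 1 := by
        gcongr
        rw [div_le_one hμ0]
        linarith
      _ = _ := mul_one _
  have e3 : 1 / q ^ 3 ≤ 27 / μ ^ 2 := by
    calc 1 / q ^ 3 ≤ 1 / (μ / 3) ^ 3 := by gcongr
      _ = 27 / μ ^ 2 * (1 / μ) := by field_simp; norm_num
      _ ≤ 27 / μ ^ 2 * 1 := by
        gcongr
        rw [div_le_one hμ0]
        linarith
      _ = _ := mul_one _
  have e4 : (4 * π ^ 2 + 32 * π ^ 4 + 27) / μ ^ 2 =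
      4 * π ^ 2 / μ ^ 2 + 32 * π ^ 4 / μ ^ 2 + 27 / μ ^ 2 := by ring
  rw [e4]
  rw [abs_le] at h1 h2 ⊢
  constructor <;> linarith [h1.1, h1.2, h2.1, h2.2]

theorem isBigO_one_log : (fun _ : ℝ => (1 : ℝ)) =O[atTop] log := by
  refine IsBigO.of_bound 1 ?_
  filter_upwards [tendsto_log_atTop.eventually_ge_atTop 1] with μ hμ
  rw [norm_one, one_mul, Real.norm_of_nonneg (by linarith)]
  exact hμ

theorem isBigO_leadingSolution {U : ℝ → ℝ}
    (hU : ∀ᶠ μ in atTop, IsLeadingSolution (μ ^ 4) (U μ)) :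
    (fun μ => U μ - 1 / 2 - (1 / √2 * μ + 1 / (48 * √2) *
      (12 * log μ + 18 * log 2 + 18 - 4 * π ^ 2) / μ)) =O[atTop] fun μ => log μ / μ ^ 2 := by
  -- The equation is multiplied by `u`, and `log (2q) = log 2 + log μ - (log ρ) / 2` is split
  -- between `α` (depending on `μ`) and `h` (depending on `ρ`).
  have hmain := isBigO_sub_quadratic_expansion (X := U) (c := 1) (K := 1 / 2) (a := 1 / 2) (b := 3)
    (α := fun μ => 1 / 4 + (log 2 + log μ) / 2) (w := log)
    (h := fun ρ => -(ρ * log ρ) / 4 - π ^ 2 / (24 * ρ)) (by norm_num) (by norm_num) ?_ ?_ ?_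
    isBigO_one_log isLittleO_log_id_atTop.isBigO ?_ ?_
  · refine hmain.congr_left fun μ => ?_
    have h2 : √(1 / 2 : ℝ) = 1 / √2 := by rw [Real.sqrt_div zero_le_one, Real.sqrt_one]
    have hs : √(2 : ℝ) ≠ 0 := by positivity
    have hs2 : √(2 : ℝ) ^ 2 = 2 := Real.sq_sqrt (by norm_num)
    have hlog : log (1 / 2 : ℝ) = -log 2 := by rw [one_div, log_inv]
    rw [h2, hlog]
    have key : ∀ Y : ℝ, Y / (2 * (1 / √2) * μ) = Y / √2 / μ := by
      intro Y
      rw [show 2 * (1 / √2) = √2 by field_simp; exact hs2.symm, div_div]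
    rw [key]
    ring
  · filter_upwards [hU, eventually_ge_atTop 1] with μ h1 h2
    exact h1.bounds h2
  · have hpos : ∀ ρ ∈ Set.Icc ((1 / 2 : ℝ) ^ 2) (3 ^ 2), ρ ≠ 0 := by
      rintro ρ ⟨h1, -⟩
      have : (0 : ℝ) < (1 / 2) ^ 2 := by positivity
      linarith
    refine ContinuousOn.sub (ContinuousOn.div_const (ContinuousOn.neg ?_) _) ?_
    · exact continuousOn_id.mul (continuousOn_id.log hpos)
    · exact continuousOn_const.div (continuousOn_const.mul continuousOn_id) fun ρ hρ =>
        mul_ne_zero (by norm_num) (hpos ρ hρ)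
  · have hne : (1 / 2 : ℝ) ≠ 0 := by norm_num
    have hne' : (24 * (1 / 2) : ℝ) ≠ 0 := by norm_num
    exact (((differentiableAt_id.mul (differentiableAt_log hne)).neg).div_const 4).sub
      ((differentiableAt_const _).div ((differentiableAt_const _).mul differentiableAt_id) hne')
  · have hc : ∀ d : ℝ, (fun _ : ℝ => d) =O[atTop] log := fun d =>
      (isBigO_const_const d one_ne_zero atTop).trans isBigO_one_log
    refine ((hc (1 / 4 + log 2 / 2)).add
      ((isBigO_refl log atTop).const_mul_left (1 / 2))).congr_left fun μ => ?_
    ring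
  · refine IsBigO.of_bound (3 * (4 * π ^ 2 + 32 * π ^ 4 + 27)) ?_
    filter_upwards [hU, eventually_ge_atTop 8] with μ h1 hμ
    obtain ⟨hlo, hhi⟩ := h1.bounds (by linarith)
    have hE := h1.strongCoupling_equation hμ
    have hμ0 : 0 < μ := by linarith
    have hu0 : 0 < U μ := by linarith
    set u := U μ
    have hlog1 : log (2 * (μ ^ 2 / u)) = log 2 + log μ - log ((u / μ) ^ 2) / 2 := by
      rw [log_pow, log_mul (by norm_num) (by positivity), log_div (by positivity) hu0.ne',
        log_div hu0.ne' hμ0.ne', log_pow]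
      push_cast
      ring
    rw [hlog1] at hE
    set ℓ := log ((u / μ) ^ 2)
    have hid : u ^ 2 - 1 * u - 1 / 2 * μ ^ 2 - ((1 / 4 + (log 2 + log μ) / 2) * (u / μ) ^ 2 +
        (-((u / μ) ^ 2 * ℓ) / 4 - π ^ 2 / (24 * (u / μ) ^ 2))) =
        u * (u - 1 - (μ ^ 2 / u / 2 + 1 / (4 * (μ ^ 2 / u)) +
          (log 2 + log μ - ℓ / 2) / (2 * (μ ^ 2 / u))) + π ^ 2 * μ ^ 2 / (24 * u ^ 3)) := by
      field_simp
      ring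
    rw [hid, norm_mul, Real.norm_of_nonneg hu0.le, Real.norm_eq_abs,
      Real.norm_of_nonneg (by positivity : 0 ≤ 1 / μ)]
    calc u * _ ≤ 3 * μ * ((4 * π ^ 2 + 32 * π ^ 4 + 27) / μ ^ 2) := by gcongr
      _ = _ := by field_simp

/-! ### The correction `z₂` at strong coupling -/

theorem IsLeadingSolution.abs_angleEnergy_sub_le {μ u : ℝ} (hμ : 8 ≤ μ)
    (h : IsLeadingSolution (μ ^ 4) u) :
    |angleEnergy (μ ^ 4) (π / u) - μ ^ 2 / u| ≤ (8 + 6 * π ^ 2 + 32 * π ^ 4) / μ := by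
  obtain ⟨hlo, hhi⟩ := h.bounds (by linarith)
  have hμ0 : 0 < μ := by linarith
  have hu0 : 0 < u := by linarith
  have hpi := pi_pos
  have h1 := _root_.abs_angleEnergy_sub_le (μ := μ) zero_le_one hu0 (by
    rw [mul_one, div_le_one hu0]
    linarith [pi_le_four])
  set q := μ ^ 2 / u with hq
  have hqlo : μ / 3 ≤ q := by
    rw [hq, div_le_div_iff₀ (by norm_num) hu0]
    nlinarith
  have hq0 : 0 < q := by positivity
  have h2 := abs_sqrt_one_add_sq_sub_le hq0
  simp only [mul_one, one_pow] at h1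
  have hμ1 : 1 / μ ≤ 1 := by
    rw [div_le_one hμ0]
    linarith
  have e1 : (π / u) ^ 2 ≤ 4 * π ^ 2 / μ := by
    calc (π / u) ^ 2 ≤ (π / (1 / 2 * μ)) ^ 2 := by gcongr
      _ = 4 * π ^ 2 / μ * (1 / μ) := by field_simp; norm_num
      _ ≤ 4 * π ^ 2 / μ * 1 := by gcongr
      _ = _ := mul_one _
  have e2 : π ^ 4 * μ ^ 2 / u ^ 5 ≤ 32 * π ^ 4 / μ := by
    calc π ^ 4 * μ ^ 2 / u ^ 5 ≤ π ^ 4 * μ ^ 2 / (1 / 2 * μ) ^ 5 := by gcongr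
      _ = 32 * π ^ 4 / μ * (1 / μ) ^ 2 := by field_simp; norm_num
      _ ≤ 32 * π ^ 4 / μ * 1 ^ 2 := by gcongr
      _ = _ := by ring
  have e3 : 1 / (8 * q ^ 3) ≤ 4 / μ := by
    calc 1 / (8 * q ^ 3) ≤ 1 / (8 * (μ / 3) ^ 3) := by gcongr
      _ = 27 / 8 / μ * (1 / μ) ^ 2 := by field_simp; norm_num
      _ ≤ 4 / μ * 1 ^ 2 := by gcongr; norm_num
      _ = _ := by ring
  have e4 : 1 / (2 * q) ≤ 4 / μ := by
    calc 1 / (2 * q) ≤ 1 / (2 * (μ / 3)) := by gcongr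
      _ = 3 / 2 / μ := by field_simp
      _ ≤ 4 / μ := by gcongr; norm_num
  have e5 : π ^ 2 * μ ^ 2 / (6 * u ^ 3) ≤ 2 * π ^ 2 / μ := by
    calc π ^ 2 * μ ^ 2 / (6 * u ^ 3) ≤ π ^ 2 * μ ^ 2 / (6 * (1 / 2 * μ) ^ 3) := by gcongr
      _ = 4 / 3 * π ^ 2 / μ := by field_simp; norm_num
      _ ≤ 2 * π ^ 2 / μ := by gcongr; norm_num
  have e4' : 0 < 1 / (2 * q) := by positivity
  have e5' : 0 < π ^ 2 * μ ^ 2 / (6 * u ^ 3) := by positivity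
  have e6 : (8 + 6 * π ^ 2 + 32 * π ^ 4) / μ =
      4 / μ + 4 / μ + 4 * π ^ 2 / μ + 2 * π ^ 2 / μ + 32 * π ^ 4 / μ := by ring
  rw [e6]
  rw [abs_le] at h1 h2 ⊢
  constructor <;> linarith [h1.1, h1.2, h2.1, h2.2]

/-- Replacing `sin (2π/u)` by `2π/u` and `S` by `q` leaves `-μ² / (6 (1 + q))`, that is `-u / (6 (1
+ u / μ²))`, which is then expanded in `u / μ²`. The three error terms match these three
replacements. -/
theorem IsLeadingSolution.abs_zTwo_add_le {μ u : ℝ} (hμ : 8 ≤ μ)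
    (h : IsLeadingSolution (μ ^ 4) u) :
    |zTwo (μ ^ 4) u + 1 / 6 * (u - (u / μ) ^ 2)| ≤
      (36 * π ^ 2 + 9 * (8 + 6 * π ^ 2 + 32 * π ^ 4) + 27) / μ := by
  have hS := h.abs_angleEnergy_sub_le hμ
  obtain ⟨hlo, hhi⟩ := h.bounds (by linarith)
  have hμ0 : 0 < μ := by linarith
  have hu0 : 0 < u := by linarith
  have hpi := pi_pos
  have hSlo := le_angleEnergy_pow_four (μ := μ) zero_le_one hu0 (by
    rw [mul_one]
    gcongr
    linarith)
  rw [mul_one, mul_one] at hSlo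
  have hz : zTwo (μ ^ 4) u = -(μ ^ 4 / (12 * π) * sin (2 * π / u)) *
      (1 / (angleEnergy (μ ^ 4) (π / u) * (1 + angleEnergy (μ ^ 4) (π / u)))) := by
    rw [zTwo, angleEnergy]
    ring
  rw [hz]
  set S := angleEnergy (μ ^ 4) (π / u)
  set C := 8 + 6 * π ^ 2 + 32 * π ^ 4
  set q := μ ^ 2 / u with hq
  have hqlo : μ / 3 ≤ q := by
    rw [hq, div_le_div_iff₀ (by norm_num) hu0]
    nlinarith
  have hq0 : 0 < q := by positivity
  have hSμ : μ / 6 ≤ S := by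
    refine le_trans ?_ hSlo
    have : 1 / 2 ≤ 2 / π := by
      rw [div_le_div_iff₀ (by norm_num) hpi]
      linarith [pi_le_four]
    calc μ / 6 = 1 / 2 * (μ / 3) := by ring
      _ ≤ 2 / π * q := by gcongr
  have hS0 : 0 < S := by linarith
  set A := μ ^ 4 / (12 * π) * sin (2 * π / u)
  have hA : |A - μ ^ 2 * q / 6| ≤ π ^ 2 * μ := by
    have h1 := abs_sub_sin_le (2 * π / u)
    rw [abs_of_pos (by positivity : 0 < 2 * π / u)] at h1
    have h2 : A - μ ^ 2 * q / 6 = -(μ ^ 4 / (12 * π) * (2 * π / u - sin (2 * π / u))) := by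
      simp only [A, hq]
      field_simp
      ring
    rw [h2, abs_neg, abs_mul, abs_of_pos (by positivity)]
    calc μ ^ 4 / (12 * π) * |2 * π / u - sin (2 * π / u)|
        ≤ μ ^ 4 / (12 * π) * ((2 * π / (1 / 2 * μ)) ^ 3 / 6) := by
          gcongr
          refine h1.trans ?_
          gcongr
      _ = 8 / 9 * (π ^ 2 * μ) := by field_simp; norm_num
      _ ≤ π ^ 2 * μ := by
        have : 0 < π ^ 2 * μ := by positivity
        linarith
  have hT1 : |(A - μ ^ 2 * q / 6) * (1 / (S * (1 + S)))| ≤ 36 * π ^ 2 / μ := by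
    rw [abs_mul, abs_of_pos (by positivity : 0 < 1 / (S * (1 + S)))]
    calc |A - μ ^ 2 * q / 6| * (1 / (S * (1 + S)))
        ≤ π ^ 2 * μ * (1 / (μ / 6 * (μ / 6))) := by
          gcongr
          linarith
      _ = 36 * π ^ 2 / μ := by field_simp; norm_num
  have hT2 : |μ ^ 2 / 6 * (S - q) * (1 / S) * ((S + q + 1) / ((1 + S) * (1 + q)))| ≤
      9 * C / μ := by
    rw [abs_mul, abs_mul, abs_mul, abs_of_pos (by positivity : 0 < μ ^ 2 / 6),
      abs_of_pos (by positivity : 0 < 1 / S),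
      abs_of_pos (by positivity : 0 < (S + q + 1) / ((1 + S) * (1 + q)))]
    have hW : (S + q + 1) / ((1 + S) * (1 + q)) ≤ 9 / μ := by
      calc (S + q + 1) / ((1 + S) * (1 + q)) ≤ (S + q + 2) / ((1 + S) * (1 + q)) := by
            gcongr
            norm_num
        _ = 1 / (1 + q) + 1 / (1 + S) := by
            field_simp
            ring
        _ ≤ 1 / (μ / 3) + 1 / (μ / 6) := by
            gcongr <;> linarith
        _ = 9 / μ := by
            field_simp
            norm_num
    calc μ ^ 2 / 6 * |S - q| * (1 / S) * ((S + q + 1) / ((1 + S) * (1 + q)))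
        ≤ μ ^ 2 / 6 * (C / μ) * (1 / (μ / 6)) * (9 / μ) := by gcongr
      _ = 9 * C / μ := by field_simp
  have hT3 : |1 / 6 * (u ^ 3 / (μ ^ 2 * (μ ^ 2 + u)))| ≤ 27 / μ := by
    rw [abs_of_pos (by positivity)]
    calc 1 / 6 * (u ^ 3 / (μ ^ 2 * (μ ^ 2 + u))) ≤ 1 * ((3 * μ) ^ 3 / (μ ^ 2 * μ ^ 2)) := by
          gcongr
          · norm_num
          · linarith
      _ = 27 / μ := by field_simp; norm_num
  have hid : -A * (1 / (S * (1 + S))) + 1 / 6 * (u - (u / μ) ^ 2) =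
      -((A - μ ^ 2 * q / 6) * (1 / (S * (1 + S)))) +
        μ ^ 2 / 6 * (S - q) * (1 / S) * ((S + q + 1) / ((1 + S) * (1 + q))) -
        1 / 6 * (u ^ 3 / (μ ^ 2 * (μ ^ 2 + u))) := by
    have h1 : 1 / 6 * (u - (u / μ) ^ 2) =
        μ ^ 2 / 6 / (1 + q) - 1 / 6 * (u ^ 3 / (μ ^ 2 * (μ ^ 2 + u))) := by
      rw [hq]
      field_simp
      ring
    rw [h1]
    generalize u ^ 3 / (μ ^ 2 * (μ ^ 2 + u)) = T
    clear_value q S A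
    field_simp
    ring
  rw [hid]
  have e : (36 * π ^ 2 + 9 * C + 27) / μ = 36 * π ^ 2 / μ + 9 * C / μ + 27 / μ := by ring
  rw [e]
  rw [abs_le] at hT1 hT2 hT3 ⊢
  constructor <;> linarith [hT1.1, hT1.2, hT2.1, hT2.2, hT3.1, hT3.2]

theorem isBigO_inv_log_div : (fun μ : ℝ => 1 / μ) =O[atTop] fun μ => log μ / μ := by
  simpa [div_eq_mul_inv] using isBigO_one_log.mul (isBigO_refl (fun μ : ℝ => 1 / μ) atTop)

theorem isBigO_log_div_one : (fun μ : ℝ => log μ / μ) =O[atTop] fun _ => (1 : ℝ) := by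
  have h := isLittleO_log_id_atTop.isBigO.mul (isBigO_refl (fun μ : ℝ => 1 / μ) atTop)
  refine h.congr' (Eventually.of_forall fun μ => by ring) ?_
  filter_upwards [eventually_gt_atTop 0] with μ hμ
  simp [hμ.ne']

theorem isBigO_leadingSolution_leading {U : ℝ → ℝ}
    (hU : ∀ᶠ μ in atTop, IsLeadingSolution (μ ^ 4) (U μ)) :
    (fun μ => U μ - 1 / 2 - 1 / √2 * μ) =O[atTop] fun μ => log μ / μ := by
  have h1 := isBigO_leadingSolution hU
  have hc : ∀ d : ℝ, (fun _ : ℝ => d) =O[atTop] log := fun d =>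
    (isBigO_const_const d one_ne_zero atTop).trans isBigO_one_log
  have h2 : (fun μ => 1 / (48 * √2) * (12 * log μ + 18 * log 2 + 18 - 4 * π ^ 2) / μ)
      =O[atTop] fun μ => log μ / μ := by
    have h3 : (fun μ => 12 * log μ + (18 * log 2 + 18 - 4 * π ^ 2)) =O[atTop] log :=
      ((isBigO_refl log atTop).const_mul_left 12).add (hc _)
    have h4 := (h3.mul (isBigO_refl (fun μ : ℝ => 1 / μ) atTop)).const_mul_left (1 / (48 * √2))
    refine h4.congr (fun μ => by ring) (fun μ => by ring)
  have h5 : (fun μ : ℝ => log μ / μ ^ 2) =O[atTop] fun μ => log μ / μ := by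
    refine IsBigO.of_bound 1 ?_
    filter_upwards [eventually_ge_atTop 1] with μ hμ
    rw [one_mul, norm_div, norm_div, Real.norm_of_nonneg (by linarith : 0 ≤ μ),
      Real.norm_of_nonneg (by positivity : 0 ≤ μ ^ 2)]
    gcongr
    nlinarith
  refine ((h1.trans h5).add h2).congr_left fun μ => ?_
  ring

/-- The term of order `μ⁰` cancels: `u` contributes the constant `1/2` and `(u / μ)²` tends to
`1/2`. -/
theorem isBigO_zTwo {U : ℝ → ℝ} (hU : ∀ᶠ μ in atTop, IsLeadingSolution (μ ^ 4) (U μ)) :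
    (fun μ => zTwo (μ ^ 4) (U μ) - (-(1 / (6 * √2)) * μ)) =O[atTop] fun μ => log μ / μ := by
  have h1 : (fun μ => zTwo (μ ^ 4) (U μ) + 1 / 6 * (U μ - (U μ / μ) ^ 2)) =O[atTop]
      fun μ => log μ / μ := by
    refine IsBigO.trans (IsBigO.of_bound
      (36 * π ^ 2 + 9 * (8 + 6 * π ^ 2 + 32 * π ^ 4) + 27) ?_) isBigO_inv_log_div
    filter_upwards [hU, eventually_ge_atTop 8] with μ h hμ
    rw [Real.norm_eq_abs, Real.norm_of_nonneg (by positivity), mul_one_div]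
    exact h.abs_zTwo_add_le hμ
  have h2 := isBigO_leadingSolution_leading hU
  have h3 : (fun μ => (U μ / μ) ^ 2 - 1 / 2) =O[atTop] fun μ => log μ / μ := by
    have hone : (fun μ => U μ - 1 / √2 * μ) =O[atTop] fun _ => (1 : ℝ) := by
      refine ((h2.trans isBigO_log_div_one).add
        (isBigO_const_const (1 / 2 : ℝ) one_ne_zero atTop)).congr_left fun μ => ?_
      ring
    have hsum : (fun μ => (U μ + 1 / √2 * μ) / μ) =O[atTop] fun _ => (1 : ℝ) := by
      refine IsBigO.of_bound (3 + 1 / √2) ?_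
      filter_upwards [hU, eventually_ge_atTop 1] with μ h hμ
      obtain ⟨hlo, hhi⟩ := h.bounds hμ
      have hμ0 : 0 < μ := by linarith
      have hu0 : 0 < U μ := by linarith
      rw [Real.norm_of_nonneg (by positivity), norm_one, mul_one, div_le_iff₀ hμ0]
      linarith
    refine IsBigO.trans ?_ isBigO_inv_log_div
    have h4 := (hone.mul hsum).mul (isBigO_refl (fun μ : ℝ => 1 / μ) atTop)
    refine h4.congr' ?_ (Eventually.of_forall fun μ => by simp)
    filter_upwards [eventually_gt_atTop 0] with μ hμ
    have hs : √(2 : ℝ) ≠ 0 := by positivity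
    have hs2 : √(2 : ℝ) ^ 2 = 2 := Real.sq_sqrt (by norm_num)
    field_simp
    linear_combination μ ^ 2 * hs2
  refine ((h1.sub (h2.const_mul_left (1 / 6))).add (h3.const_mul_left (1 / 6))).congr_left
    fun μ => ?_
  have : 1 / (6 * √2) = 1 / 6 * (1 / √2) := by
    field_simp
  rw [this]
  ring

/-! ### The Bethe equation at fixed length and strong coupling -/

/-- The modes `±n` pair up, and the zero mode contributes exactly 1 at every coupling. That 1 makes
the linear coefficient of the quadratic `L + 1`, hence the term `1 / (2L)`. -/
theorem energySum_eq_range (lam : ℝ) (m : ℕ) (x : ℝ) :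
    energySum lam m x =
      1 + 2 * ∑ k ∈ Finset.range m, angleEnergy lam (π / x * (2 * ((k : ℝ) + 1))) := by
  have heven : (fun n : ℤ => angleEnergy lam (2 * π * n / x)).Even := by
    intro n
    beta_reduce
    rw [← angleEnergy_neg]
    congr 1
    push_cast
    ring
  rw [energySum, Finset.sum_Icc_of_even_eq_range heven, Finset.sum_range_succ']
  simp only [Nat.cast_zero, Int.cast_zero, mul_zero, zero_div, angleEnergy_zero, nsmul_eq_mul]
  have : ∀ k : ℕ, angleEnergy lam (2 * π * ((((k + 1 : ℕ) : ℤ)) : ℝ) / x) =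
      angleEnergy lam (π / x * (2 * ((k : ℝ) + 1))) := by
    intro k
    congr 1
    push_cast
    ring
  simp only [this]
  push_cast
  ring

theorem sum_range_succ_cast (m : ℕ) :
    ∑ k ∈ Finset.range m, ((k : ℝ) + 1) = m * (m + 1) / 2 := by
  induction m with
  | zero => simp
  | succ m ih =>
    rw [Finset.sum_range_succ, ih]
    push_cast
    ring

theorem sum_range_succ_cast_cube (m : ℕ) :
    ∑ k ∈ Finset.range m, ((k : ℝ) + 1) ^ 3 = (m : ℝ) ^ 2 * (m + 1) ^ 2 / 4 := by
  induction m with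
  | zero => simp
  | succ m ih =>
    rw [Finset.sum_range_succ, ih]
    push_cast
    ring

theorem IsHighestEnergy.bounds {μ D : ℝ} {m : ℕ} (hm : 1 ≤ m) (hμ : 1 ≤ μ)
    (h : IsHighestEnergy (2 * m + 1) (μ ^ 4) D) :
    1 * μ ≤ D + (2 * (m : ℝ) + 1) / 2 ∧
      D + (2 * (m : ℝ) + 1) / 2 ≤ 3 * (2 * (m : ℝ) + 1) * μ := by
  have h2 := h.le_add (by positivity)
  have heq := ((isHighestEnergy_iff _ m D).1 h).2
  push_cast at h2 heq
  set x := D + (2 * (m : ℝ) + 1) / 2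
  have hm1 : (1 : ℝ) ≤ m := by exact_mod_cast hm
  have hx0 : 0 < x := by linarith
  have hpi := pi_pos
  rw [energySum_eq_range] at heq
  have hq0 : 0 ≤ μ ^ 2 / x := by positivity
  have hmul : μ ^ 2 / x * x = μ ^ 2 := div_mul_cancel₀ _ hx0.ne'
  have hlo : μ ^ 2 / x ≤ ∑ k ∈ Finset.range m, angleEnergy (μ ^ 4) (π / x * (2 * ((k : ℝ) + 1))) := by
    -- Mode number 1 alone gives the lower bound. It is present because `m ≥ 1`; for `L = 1` only
    -- the zero mode is left and the energy does not grow.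
    have h3 : angleEnergy (μ ^ 4) (π / x * (2 * (((0 : ℕ) : ℝ) + 1))) ≤
        ∑ k ∈ Finset.range m, angleEnergy (μ ^ 4) (π / x * (2 * ((k : ℝ) + 1))) :=
      Finset.single_le_sum (f := fun k : ℕ => angleEnergy (μ ^ 4) (π / x * (2 * ((k : ℝ) + 1))))
        (fun k _ => Real.sqrt_nonneg _) (Finset.mem_range.2 hm)
    have h4 := le_angleEnergy_pow_four (μ := μ) (t := 2 * (((0 : ℕ) : ℝ) + 1)) (by positivity) hx0
      (by
        rw [div_mul_eq_mul_div, div_le_div_iff₀ hx0 (by norm_num)]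
        push_cast
        nlinarith)
    refine le_trans ?_ (h4.trans h3)
    have h5 : 1 / 2 ≤ 2 / π := by
      rw [div_le_div_iff₀ (by norm_num) hpi]
      linarith [pi_le_four]
    calc μ ^ 2 / x = 1 / 2 * (μ ^ 2 / x * (2 * (((0 : ℕ) : ℝ) + 1))) := by push_cast; ring
      _ ≤ _ := by gcongr
  have hhi : ∑ k ∈ Finset.range m, angleEnergy (μ ^ 4) (π / x * (2 * ((k : ℝ) + 1))) ≤
      m * (1 + μ ^ 2 / x * (2 * m)) := by
    have := Finset.sum_le_card_nsmul (Finset.range m)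
      (fun k : ℕ => angleEnergy (μ ^ 4) (π / x * (2 * ((k : ℝ) + 1)))) (1 + μ ^ 2 / x * (2 * m))
      fun k hk => by
        refine (angleEnergy_pow_four_le (by positivity) hx0).trans ?_
        have : (k : ℝ) + 1 ≤ m := by exact_mod_cast Finset.mem_range.1 hk
        gcongr
    rwa [Finset.card_range, nsmul_eq_mul] at this
  set q := μ ^ 2 / x
  constructor
  · have h1 : q ≤ x := by linarith
    have h3 : μ ^ 2 ≤ x ^ 2 := by nlinarith
    rw [one_mul]
    exact (sq_le_sq₀ (by linarith) hx0.le).1 h3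
  · by_contra hcon
    push Not at hcon
    have hL : (0 : ℝ) < 2 * m + 1 := by positivity
    have h1 : x ≤ 2 * (2 * m + 1) + q * (2 * m + 1) ^ 2 := by
      nlinarith [mul_nonneg hq0 (by positivity : (0 : ℝ) ≤ m)]
    have h3 : x ^ 2 ≤ 2 * (2 * m + 1) * x + μ ^ 2 * (2 * m + 1) ^ 2 := by
      calc x ^ 2 = x * x := sq x
        _ ≤ (2 * (2 * m + 1) + q * (2 * m + 1) ^ 2) * x := by gcongr
        _ = 2 * (2 * m + 1) * x + q * x * (2 * m + 1) ^ 2 := by ring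
        _ = _ := by rw [hmul]
    set ℓ : ℝ := 2 * m + 1
    have h4 : ℓ * 1 ≤ ℓ * μ := by gcongr
    have h5 : 3 * ℓ * μ * x ≤ x ^ 2 := by nlinarith
    have h6 : ℓ * x ≤ μ ^ 2 * ℓ ^ 2 := by nlinarith
    nlinarith [mul_pos hL hx0]

/-- The energy is expanded mode by mode with `t = 2(k + 1)`. The terms `1 / (2qt)` sum to a harmonic
number where the integral gave a logarithm. The condition on `μ` ensures `π t / x ≤ 1` for all
modes. -/
theorem IsHighestEnergy.strongCoupling_equation {μ D : ℝ} {m : ℕ} (hm : 1 ≤ m)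
    (hμ : 4 * (2 * (m : ℝ) + 1) ≤ μ) (h : IsHighestEnergy (2 * m + 1) (μ ^ 4) D) {x : ℝ}
    (hx : x = D + (2 * (m : ℝ) + 1) / 2) :
    |x - (2 * m + 2) - (μ ^ 2 / x * (2 * m * (m + 1)) +
      x / (2 * μ ^ 2) * (∑ k ∈ Finset.range m, 1 / ((k : ℝ) + 1)) -
      π ^ 2 * μ ^ 2 / (6 * x ^ 3) * (2 * m * (m + 1)) ^ 2)| ≤
      2 * m * (π ^ 2 * (2 * m + 1) ^ 2 + π ^ 4 * (2 * m + 1) ^ 5 + 27 * (2 * m + 1) ^ 3)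
        / μ ^ 2 := by
  have hm1 : (1 : ℝ) ≤ m := by exact_mod_cast hm
  obtain ⟨hlo, hhi⟩ := h.bounds hm (by linarith)
  have heq := ((isHighestEnergy_iff _ m D).1 h).2
  push_cast at heq
  rw [← hx] at hlo hhi heq
  rw [energySum_eq_range] at heq
  rw [one_mul] at hlo
  have hpi := pi_pos
  have hμ1 : 1 ≤ μ := by linarith
  have hμ0 : 0 < μ := by linarith
  have hx0 : 0 < x := by linarith
  set q := μ ^ 2 / x with hq
  set ℓ : ℝ := 2 * m + 1 with hℓ
  have hℓ0 : 0 < ℓ := by positivity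
  have hqlo : μ / (3 * ℓ) ≤ q := by
    rw [hq, div_le_div_iff₀ (by positivity) hx0]
    nlinarith
  have hq0 : 0 < q := by positivity
  have hμinv : 1 / μ ≤ 1 := by
    rw [div_le_one hμ0]
    exact hμ1
  have hterm : ∀ k ∈ Finset.range m,
      |angleEnergy (μ ^ 4) (π / x * (2 * ((k : ℝ) + 1))) -
        (2 * q * ((k : ℝ) + 1) + 1 / (4 * q) * (1 / ((k : ℝ) + 1)) -
          8 * (π ^ 2 * μ ^ 2 / (6 * x ^ 3)) * ((k : ℝ) + 1) ^ 3)| ≤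
      (π ^ 2 * ℓ ^ 2 + π ^ 4 * ℓ ^ 5 + 27 * ℓ ^ 3) / μ ^ 2 := by
    intro k hk
    have hk1 : (k : ℝ) + 1 ≤ m := by exact_mod_cast Finset.mem_range.1 hk
    set t : ℝ := 2 * ((k : ℝ) + 1) with ht
    have ht1 : 1 ≤ t := by
      have : (0 : ℝ) ≤ k := by positivity
      linarith
    have ht0 : 0 < t := by linarith
    have htℓ : t ≤ ℓ := by linarith
    have h1 := abs_angleEnergy_sub_le (μ := μ) ht0.le hx0 (by
      rw [div_mul_eq_mul_div, div_le_one hx0]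
      calc π * t ≤ 4 * ℓ := by
            gcongr
            exact pi_le_four
        _ ≤ x := by linarith)
    rw [← hq] at h1
    have h2 := abs_sqrt_one_add_sq_sub_le (by positivity : 0 < q * t)
    have e1 : (π / x * t) ^ 2 ≤ π ^ 2 * ℓ ^ 2 / μ ^ 2 := by
      calc (π / x * t) ^ 2 ≤ (π / μ * ℓ) ^ 2 := by gcongr
        _ = _ := by field_simp
    have e2 : π ^ 4 * μ ^ 2 / x ^ 5 * t ^ 5 ≤ π ^ 4 * ℓ ^ 5 / μ ^ 2 := by
      calc π ^ 4 * μ ^ 2 / x ^ 5 * t ^ 5 ≤ π ^ 4 * μ ^ 2 / μ ^ 5 * ℓ ^ 5 := by gcongr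
        _ = π ^ 4 * ℓ ^ 5 / μ ^ 2 * (1 / μ) := by field_simp
        _ ≤ π ^ 4 * ℓ ^ 5 / μ ^ 2 * 1 := by gcongr
        _ = _ := mul_one _
    have e3 : 1 / (8 * (q * t) ^ 3) ≤ 27 * ℓ ^ 3 / μ ^ 2 := by
      calc 1 / (8 * (q * t) ^ 3) ≤ 1 / (1 * (μ / (3 * ℓ) * 1) ^ 3) := by
            gcongr
            norm_num
        _ = 27 * ℓ ^ 3 / μ ^ 2 * (1 / μ) := by
            field_simp
            norm_num
        _ ≤ 27 * ℓ ^ 3 / μ ^ 2 * 1 := by gcongr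
        _ = _ := mul_one _
    have e4 : (π ^ 2 * ℓ ^ 2 + π ^ 4 * ℓ ^ 5 + 27 * ℓ ^ 3) / μ ^ 2 =
        π ^ 2 * ℓ ^ 2 / μ ^ 2 + π ^ 4 * ℓ ^ 5 / μ ^ 2 + 27 * ℓ ^ 3 / μ ^ 2 := by ring
    have e5 : 2 * q * ((k : ℝ) + 1) + 1 / (4 * q) * (1 / ((k : ℝ) + 1)) -
          8 * (π ^ 2 * μ ^ 2 / (6 * x ^ 3)) * ((k : ℝ) + 1) ^ 3 =
        q * t + 1 / (2 * (q * t)) - π ^ 2 * μ ^ 2 / (6 * x ^ 3) * t ^ 3 := by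
      rw [ht]
      field_simp
      ring
    rw [e4, e5]
    rw [abs_le] at h1 h2 ⊢
    constructor <;> linarith [h1.1, h1.2, h2.1, h2.2]
  have htotal := (Finset.abs_sum_le_sum_abs _ _).trans (Finset.sum_le_card_nsmul _ _ _ hterm)
  rw [Finset.card_range, nsmul_eq_mul, Finset.sum_sub_distrib, Finset.sum_sub_distrib,
    Finset.sum_add_distrib, ← Finset.mul_sum, ← Finset.mul_sum, ← Finset.mul_sum,
    sum_range_succ_cast, sum_range_succ_cast_cube] at htotal
  set T := ∑ k ∈ Finset.range m, angleEnergy (μ ^ 4) (π / x * (2 * ((k : ℝ) + 1)))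
  set H := ∑ k ∈ Finset.range m, 1 / ((k : ℝ) + 1)
  have hid : x - (2 * m + 2) - (q * (2 * m * (m + 1)) + x / (2 * μ ^ 2) * H -
      π ^ 2 * μ ^ 2 / (6 * x ^ 3) * (2 * m * (m + 1)) ^ 2) =
      2 * (T - (2 * q * (m * (m + 1) / 2) + 1 / (4 * q) * H -
        8 * (π ^ 2 * μ ^ 2 / (6 * x ^ 3)) * (m ^ 2 * (m + 1) ^ 2 / 4))) := by
    have h1 : 1 / (4 * q) = x / (4 * μ ^ 2) := by
      rw [hq]
      field_simp
    rw [h1]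
    linear_combination heq
  rw [hid, abs_mul, abs_of_pos (by norm_num : (0 : ℝ) < 2)]
  calc _ ≤ 2 * (m * ((π ^ 2 * ℓ ^ 2 + π ^ 4 * ℓ ^ 5 + 27 * ℓ ^ 3) / μ ^ 2)) := by gcongr
    _ = _ := by ring

theorem isBigO_highestEnergy {D : ℝ → ℝ} {m : ℕ} (hm : 1 ≤ m)
    (hD : ∀ᶠ μ in atTop, IsHighestEnergy (2 * m + 1) (μ ^ 4) (D μ)) :
    (fun μ => D μ - 1 / 2 - (√(2 * m * (m + 1)) * μ + ((m + 1) ^ 2 +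
      (∑ k ∈ Finset.range m, 1 / ((k : ℝ) + 1)) / 2 * (2 * m * (m + 1)) -
      π ^ 2 / 6 * (2 * m * (m + 1))) / (2 * √(2 * m * (m + 1)) * μ)))
      =O[atTop] fun μ => 1 / μ ^ 2 := by
  have hm1 : (1 : ℝ) ≤ m := by exact_mod_cast hm
  set K : ℝ := 2 * m * (m + 1) with hKdef
  have hK : 0 < K := by positivity
  set H := ∑ k ∈ Finset.range m, 1 / ((k : ℝ) + 1) with hH
  -- Here `α` is constant, so the gauge is 1 and no logarithm appears; `X - c / 2` is `D - 1 / 2`.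
  have hmain := isBigO_sub_quadratic_expansion (X := fun μ => D μ + (2 * (m : ℝ) + 1) / 2)
    (c := 2 * m + 2) (K := K) (a := 1) (b := 3 * (2 * m + 1))
    (α := fun _ => H / 2) (w := fun _ => 1)
    (h := fun ρ => -(π ^ 2 * K ^ 2 / (6 * ρ))) hK one_pos ?_ ?_ ?_
    (isBigO_refl _ _) ?_ (isBigO_const_const _ one_ne_zero atTop) ?_
  · refine hmain.congr_left fun μ => ?_
    have : π ^ 2 * K ^ 2 / (6 * K) = π ^ 2 / 6 * K := by field_simp
    rw [this]
    ring
  · filter_upwards [hD, eventually_ge_atTop 1] with μ h1 h2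
    exact h1.bounds hm h2
  · have hpos : ∀ ρ ∈ Set.Icc ((1 : ℝ) ^ 2) ((3 * (2 * (m : ℝ) + 1)) ^ 2), ρ ≠ 0 := by
      rintro ρ ⟨h1, -⟩
      rw [one_pow] at h1
      linarith
    exact (continuousOn_const.div (continuousOn_const.mul continuousOn_id) fun ρ hρ =>
      mul_ne_zero (by norm_num) (hpos ρ hρ)).neg
  · exact ((differentiableAt_const _).div ((differentiableAt_const _).mul differentiableAt_id)
      (mul_ne_zero (by norm_num) hK.ne')).neg
  · refine IsBigO.of_bound 1 ?_
    filter_upwards [eventually_ge_atTop 1] with μ hμ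
    rw [norm_one, one_mul, Real.norm_of_nonneg (by linarith)]
    exact hμ
  · refine IsBigO.of_bound (3 * (2 * m + 1) * (2 * m * (π ^ 2 * (2 * m + 1) ^ 2 +
      π ^ 4 * (2 * m + 1) ^ 5 + 27 * (2 * m + 1) ^ 3))) ?_
    filter_upwards [hD, eventually_ge_atTop (4 * (2 * (m : ℝ) + 1))] with μ h1 hμ
    have hμ1 : 1 ≤ μ := by linarith
    have hμ0 : 0 < μ := by linarith
    obtain ⟨hlo, hhi⟩ := h1.bounds hm hμ1
    have hE := h1.strongCoupling_equation hm hμ rfl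
    set x := D μ + (2 * (m : ℝ) + 1) / 2
    rw [one_mul] at hlo
    have hx0 : 0 < x := by linarith
    rw [← hKdef, ← hH] at hE
    have hid : x ^ 2 - (2 * m + 2) * x - K * μ ^ 2 - (H / 2 * (x / μ) ^ 2 +
        -(π ^ 2 * K ^ 2 / (6 * (x / μ) ^ 2))) =
        x * (x - (2 * m + 2) - (μ ^ 2 / x * K + x / (2 * μ ^ 2) * H -
          π ^ 2 * μ ^ 2 / (6 * x ^ 3) * K ^ 2)) := by
      clear_value x K H
      field_simp
      ring
    rw [hid, norm_mul, Real.norm_of_nonneg hx0.le, Real.norm_eq_abs,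
      Real.norm_of_nonneg (by positivity : 0 ≤ 1 / μ)]
    calc x * _ ≤ 3 * (2 * m + 1) * μ * (2 * m * (π ^ 2 * (2 * m + 1) ^ 2 +
          π ^ 4 * (2 * m + 1) ^ 5 + 27 * (2 * m + 1) ^ 3) / μ ^ 2) := by gcongr
      _ = _ := by field_simp

/-! ### Change of variables `λ = μ ^ 4` -/

theorem tendsto_fourthRoot_atTop : Tendsto (fun lam : ℝ => lam ^ (1 / 4 : ℝ)) atTop atTop :=
  tendsto_rpow_atTop (by norm_num)

theorem fourthRoot_pow_four {lam : ℝ} (hlam : 0 ≤ lam) : (lam ^ (1 / 4 : ℝ)) ^ 4 = lam := by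
  rw [← Real.rpow_natCast, ← Real.rpow_mul hlam]
  norm_num

theorem rpow_neg_fourth {lam : ℝ} (hlam : 0 ≤ lam) :
    lam ^ (-1 / 4 : ℝ) = 1 / lam ^ (1 / 4 : ℝ) := by
  rw [show (-1 / 4 : ℝ) = -(1 / 4) by norm_num, Real.rpow_neg hlam, inv_eq_one_div]

theorem rpow_neg_half {lam : ℝ} (hlam : 0 ≤ lam) :
    lam ^ (-1 / 2 : ℝ) = 1 / (lam ^ (1 / 4 : ℝ)) ^ 2 := by
  rw [show (-1 / 2 : ℝ) = -(1 / 2) by norm_num, Real.rpow_neg hlam, one_div,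
    ← Real.rpow_natCast, ← Real.rpow_mul hlam]
  norm_num

theorem log_eq_four_mul_log_fourthRoot {lam : ℝ} (hlam : 0 < lam) :
    log lam = 4 * log (lam ^ (1 / 4 : ℝ)) := by
  rw [Real.log_rpow hlam]
  ring

section Leading

variable {u : ℝ → ℝ}

theorem eventually_isLeadingSolution (hu : ∀ lam : ℝ, 0 ≤ lam → IsLeadingSolution lam (u lam)) :
    ∀ᶠ μ : ℝ in atTop, IsLeadingSolution (μ ^ 4) (u (μ ^ 4)) :=
  Eventually.of_forall fun μ => hu _ (by positivity)

theorem isBigO_leading_strongCoupling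
    (hu : ∀ lam : ℝ, 0 ≤ lam → IsLeadingSolution lam (u lam)) :
    (fun lam : ℝ => u lam - 1 / 2 - (1 / √2 * lam ^ (1 / 4 : ℝ)
      + 1 / (48 * √2) * lam ^ (-1 / 4 : ℝ) * (3 * log lam + 18 * log 2 + 18 - 4 * π ^ 2)))
      =O[atTop] (fun lam : ℝ => lam ^ (-1 / 2 : ℝ) * log lam) := by
  have h := (isBigO_leadingSolution (eventually_isLeadingSolution hu)).comp_tendsto
    tendsto_fourthRoot_atTop
  refine (h.trans (isBigO_refl _ _ |>.const_mul_right (c := (4 : ℝ)) (by norm_num))).congr' ?_ ?_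
  · filter_upwards [eventually_gt_atTop 0] with lam hlam
    simp only [Function.comp_apply]
    rw [fourthRoot_pow_four hlam.le, rpow_neg_fourth hlam.le, log_eq_four_mul_log_fourthRoot hlam]
    ring
  · filter_upwards [eventually_gt_atTop 0] with lam hlam
    simp only [Function.comp_apply]
    rw [rpow_neg_half hlam.le, log_eq_four_mul_log_fourthRoot hlam]
    ring

theorem isBigO_zTwo_strongCoupling
    (hu : ∀ lam : ℝ, 0 ≤ lam → IsLeadingSolution lam (u lam)) :
    (fun lam : ℝ => zTwo lam (u lam) - (-(1 / (6 * √2)) * lam ^ (1 / 4 : ℝ)))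
      =O[atTop] (fun lam : ℝ => lam ^ (-1 / 4 : ℝ) * log lam) := by
  have h := (isBigO_zTwo (eventually_isLeadingSolution hu)).comp_tendsto tendsto_fourthRoot_atTop
  refine (h.trans (isBigO_refl _ _ |>.const_mul_right (c := (4 : ℝ)) (by norm_num))).congr' ?_ ?_
  · filter_upwards [eventually_gt_atTop 0] with lam hlam
    simp only [Function.comp_apply]
    rw [fourthRoot_pow_four hlam.le]
  · filter_upwards [eventually_gt_atTop 0] with lam hlam
    simp only [Function.comp_apply]
    rw [rpow_neg_fourth hlam.le, log_eq_four_mul_log_fourthRoot hlam]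
    ring

theorem tendsto_log_div_atTop : Tendsto (fun μ : ℝ => log μ / μ) atTop (𝓝 0) :=
  isLittleO_log_id_atTop.tendsto_div_nhds_zero

theorem tendsto_leading_sub (hu : ∀ lam : ℝ, 0 ≤ lam → IsLeadingSolution lam (u lam)) :
    Tendsto (fun lam : ℝ => u lam - 1 / 2 - 1 / √2 * lam ^ (1 / 4 : ℝ)) atTop (𝓝 0) := by
  have h := ((isBigO_leadingSolution_leading (eventually_isLeadingSolution hu)).trans_tendsto
    tendsto_log_div_atTop).comp tendsto_fourthRoot_atTop
  refine h.congr' ?_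
  filter_upwards [eventually_gt_atTop 0] with lam hlam
  simp only [Function.comp_apply]
  rw [fourthRoot_pow_four hlam.le]

theorem tendsto_zTwo_sub (hu : ∀ lam : ℝ, 0 ≤ lam → IsLeadingSolution lam (u lam)) :
    Tendsto (fun lam : ℝ => zTwo lam (u lam) - (-(1 / (6 * √2)) * lam ^ (1 / 4 : ℝ))) atTop
      (𝓝 0) := by
  have h := ((isBigO_zTwo (eventually_isLeadingSolution hu)).trans_tendsto
    tendsto_log_div_atTop).comp tendsto_fourthRoot_atTop
  refine h.congr' ?_
  filter_upwards [eventually_gt_atTop 0] with lam hlam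
  simp only [Function.comp_apply]
  rw [fourthRoot_pow_four hlam.le]

/-- If `F - c λ^{1/4}` converges then `F / λ^{1/4}` tends to `c`. -/
theorem tendsto_div_fourthRoot {F : ℝ → ℝ} {c d : ℝ}
    (h : Tendsto (fun lam : ℝ => F lam - c * lam ^ (1 / 4 : ℝ)) atTop (𝓝 d)) :
    Tendsto (fun lam : ℝ => F lam / lam ^ (1 / 4 : ℝ)) atTop (𝓝 c) := by
  have h1 := (h.div_atTop tendsto_fourthRoot_atTop).add_const c
  rw [zero_add] at h1
  refine h1.congr' ?_
  filter_upwards [eventually_gt_atTop 0] with lam hlam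
  have : lam ^ (1 / 4 : ℝ) ≠ 0 := (Real.rpow_pos_of_pos hlam _).ne'
  field_simp
  ring

end Leading

/-! ### Fixed length -/

theorem sqrt_one_sub_inv_sq (m : ℕ) :
    √(1 - 1 / ((2 * m + 1 : ℕ) : ℝ) ^ 2) = √2 * √(2 * m * (m + 1)) / (2 * m + 1) := by
  have h : 1 - 1 / ((2 * m + 1 : ℕ) : ℝ) ^ 2 = 2 * (2 * m * (m + 1)) / (2 * m + 1) ^ 2 := by
    push_cast
    field_simp
    ring
  rw [h, Real.sqrt_div (by positivity), Real.sqrt_sq (by positivity), Real.sqrt_mul (by norm_num)]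

theorem cCoeff_eq (m : ℕ) : cCoeff (2 * m + 1) = √(2 * m * (m + 1)) / (2 * m + 1) := by
  rw [cCoeff, sqrt_one_sub_inv_sq]
  field_simp

theorem eCoeff_eq {m : ℕ} (hm : 1 ≤ m) : eCoeff (2 * m + 1) = ((m + 1) ^ 2 +
      (∑ k ∈ Finset.range m, 1 / ((k : ℝ) + 1)) / 2 * (2 * m * (m + 1)) -
      π ^ 2 / 6 * (2 * m * (m + 1))) / (2 * √(2 * m * (m + 1))) / (2 * m + 1) := by
  have hm0 : (0 : ℝ) < m := by exact_mod_cast hm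
  have hsum : ∑ k ∈ Finset.Icc 1 ((2 * m + 1 - 1) / 2), 1 / (k : ℝ) =
      ∑ k ∈ Finset.range m, 1 / ((k : ℝ) + 1) := by
    rw [show (2 * m + 1 - 1) / 2 = m by omega, Finset.range_eq_Ico,
      show Finset.Icc 1 m = Finset.Ico (0 + 1) (m + 1) by ext; simp,
      ← Finset.sum_Ico_add']
    push_cast
    rfl
  rw [eCoeff, sqrt_one_sub_inv_sq, hsum]
  generalize ∑ k ∈ Finset.range m, 1 / ((k : ℝ) + 1) = H
  have hK2 : √(2 * m * (m + 1) : ℝ) ^ 2 = 2 * m * (m + 1) := Real.sq_sqrt (by positivity)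
  have hK0 : 0 < √(2 * m * (m + 1) : ℝ) := Real.sqrt_pos.2 (by positivity)
  have h2 : √(2 : ℝ) ^ 2 = 2 := Real.sq_sqrt (by norm_num)
  have hs0 : 0 < √(2 : ℝ) := by positivity
  push_cast
  generalize √(2 * m * (m + 1) : ℝ) = k at *
  generalize √(2 : ℝ) = s at *
  rw [← hK2]
  have h1 : 1 / (4 * s) * (1 + 1 / (2 * (m : ℝ) + 1)) ^ 2 / (s * k / (2 * m + 1)) =
      (m + 1) ^ 2 / (2 * k) / (2 * m + 1) := by
    have : 1 / (4 * s) * (1 + 1 / (2 * (m : ℝ) + 1)) ^ 2 / (s * k / (2 * m + 1)) =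
        (m + 1) ^ 2 / (s ^ 2 * k) / (2 * m + 1) := by
      field_simp
      ring
    rw [this, h2]
  rw [h1]
  field_simp
  ring

section FixedLength

variable {D : ℝ → ℝ} {L : ℕ}

theorem isBigO_fixedLength (hL : Odd L) (hL3 : 3 ≤ L)
    (hD : ∀ lam : ℝ, 0 ≤ lam → IsHighestEnergy L lam (D lam)) :
    (fun lam : ℝ => D lam / L - (cCoeff L * lam ^ (1 / 4 : ℝ) + 1 / (2 * (L : ℝ))
      + eCoeff L * lam ^ (-1 / 4 : ℝ))) =O[atTop] (fun lam : ℝ => lam ^ (-1 / 2 : ℝ)) := by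
  obtain ⟨m, rfl⟩ := hL
  have hm : 1 ≤ m := by omega
  have h := ((isBigO_highestEnergy (D := fun μ => D (μ ^ 4)) hm
    (Eventually.of_forall fun μ => hD _ (by positivity))).comp_tendsto
      tendsto_fourthRoot_atTop).const_mul_left (1 / (2 * (m : ℝ) + 1))
  refine h.congr' ?_ ?_
  · filter_upwards [eventually_gt_atTop 0] with lam hlam
    simp only [Function.comp_apply]
    rw [fourthRoot_pow_four hlam.le, rpow_neg_fourth hlam.le, cCoeff_eq, eCoeff_eq hm]
    push_cast
    rw [← div_div _ (2 * √(2 * m * (m + 1) : ℝ)) (lam ^ (1 / 4 : ℝ)),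
      ← div_div 1 2 (2 * (m : ℝ) + 1)]
    ring
  · filter_upwards [eventually_gt_atTop 0] with lam hlam
    simp only [Function.comp_apply]
    rw [rpow_neg_half hlam.le]

theorem tendsto_fixedLength (hL : Odd L) (hL3 : 3 ≤ L)
    (hD : ∀ lam : ℝ, 0 ≤ lam → IsHighestEnergy L lam (D lam)) :
    Tendsto (fun lam : ℝ => D lam / L - cCoeff L * lam ^ (1 / 4 : ℝ)) atTop
      (𝓝 (1 / (2 * (L : ℝ)))) := by
  have hlim : ∀ y : ℝ, 0 < y → Tendsto (fun lam : ℝ => lam ^ (-y)) atTop (𝓝 0) := fun y hy =>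
    tendsto_rpow_neg_atTop hy
  have h1 := (isBigO_fixedLength hL hL3 hD).trans_tendsto
    (by simpa [neg_div] using hlim (1 / 2) (by norm_num))
  have h2 : Tendsto (fun lam : ℝ => eCoeff L * lam ^ (-1 / 4 : ℝ)) atTop (𝓝 0) := by
    simpa [neg_div] using (hlim (1 / 4) (by norm_num)).const_mul (eCoeff L)
  have h3 := (h1.add h2).add_const (1 / (2 * (L : ℝ)))
  rw [zero_add, zero_add] at h3
  refine h3.congr fun lam => ?_
  ring

theorem cCoeff_lt (hL : 1 ≤ L) : cCoeff L < 1 / √2 := by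
  have hL0 : (0 : ℝ) < L := by exact_mod_cast hL
  have h : √(1 - 1 / (L : ℝ) ^ 2) < 1 := by
    rw [Real.sqrt_lt' one_pos]
    have : 0 < 1 / (L : ℝ) ^ 2 := by positivity
    linarith
  rw [cCoeff]
  calc 1 / √2 * √(1 - 1 / (L : ℝ) ^ 2) < 1 / √2 * 1 := by gcongr
    _ = 1 / √2 := mul_one _

/-- The strict inequality `cCoeff L < 1 / √2` leaves a negative multiple of `λ^{1/4}`. -/
theorem tendsto_fixedLength_atBot (hL : Odd L) (hL3 : 3 ≤ L)
    (hD : ∀ lam : ℝ, 0 ≤ lam → IsHighestEnergy L lam (D lam)) :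
    Tendsto (fun lam : ℝ => D lam / L - 1 / √2 * lam ^ (1 / 4 : ℝ)) atTop atBot := by
  have hc : cCoeff L - 1 / √2 < 0 := by linarith [cCoeff_lt (by omega : 1 ≤ L)]
  have h := (tendsto_fixedLength hL hL3 hD).add_atBot
    (tendsto_fourthRoot_atTop.const_mul_atTop_of_neg hc)
  refine h.congr fun lam => ?_
  ring

end FixedLength

/-! ### Large `L` behaviour of the fixed-length coefficients -/

theorem tendsto_inv_sq_oddAtTop : Tendsto (fun L : ℕ => 1 / (L : ℝ) ^ 2) oddAtTop (𝓝 0) := by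
  have := tendsto_inv_oddAtTop.pow 2
  simpa using this

theorem tendsto_sqrt_one_sub_inv_sq :
    Tendsto (fun L : ℕ => √(1 - 1 / (L : ℝ) ^ 2)) oddAtTop (𝓝 1) := by
  have h := (tendsto_inv_sq_oddAtTop.const_sub 1).sqrt
  simpa using h

theorem tendsto_cCoeff : Tendsto cCoeff oddAtTop (𝓝 (1 / √2)) := by
  have h := tendsto_sqrt_one_sub_inv_sq.const_mul (1 / √2)
  rwa [mul_one] at h

/-- Rationalising, `√(1 - ε) - 1 = -ε / (1 + √(1 - ε))` with `ε = 1 / L²`. -/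
theorem tendsto_sq_mul_cCoeff_sub :
    Tendsto (fun L : ℕ => (L : ℝ) ^ 2 * (cCoeff L - 1 / √2)) oddAtTop (𝓝 (-(1 / (2 * √2)))) := by
  have h : Tendsto (fun L : ℕ => -(1 / √2) / (1 + √(1 - 1 / (L : ℝ) ^ 2))) oddAtTop
      (𝓝 (-(1 / √2) / (1 + 1))) :=
    tendsto_const_nhds.div (tendsto_sqrt_one_sub_inv_sq.const_add 1) (by norm_num)
  have he : -(1 / √2) / (1 + 1) = -(1 / (2 * √2)) := by
    field_simp
    norm_num
  rw [he] at h
  refine h.congr' ?_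
  filter_upwards [eventually_ge_oddAtTop 1] with L hL
  have hL0 : (1 : ℝ) ≤ L := by exact_mod_cast hL
  have hle : 1 / (L : ℝ) ^ 2 ≤ 1 := by
    rw [div_le_one (by positivity)]
    nlinarith
  have hs := Real.sq_sqrt (by linarith : 0 ≤ 1 - 1 / (L : ℝ) ^ 2)
  have hs0 := Real.sqrt_nonneg (1 - 1 / (L : ℝ) ^ 2)
  rw [cCoeff]
  generalize √(1 - 1 / (L : ℝ) ^ 2) = s at *
  have hL2 : (L : ℝ) ^ 2 * (1 - s ^ 2) = 1 := by
    rw [hs]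
    field_simp
    ring
  rw [div_eq_iff (by positivity)]
  linear_combination (1 / √2) * hL2

theorem tendsto_log_oddAtTop : Tendsto (fun L : ℕ => log (L : ℝ)) oddAtTop atTop :=
  tendsto_log_atTop.comp tendsto_natCast_oddAtTop

/-- Squeeze from `log (m + 1) ≤ H_m ≤ 1 + log m` with `L = 2m + 1`, where `m + 1 ≥ L / 2` and `m ≤
L`. -/
theorem tendsto_harmonic_div_log : Tendsto
    (fun L : ℕ => (∑ k ∈ Finset.Icc 1 ((L - 1) / 2), 1 / (k : ℝ)) / log L) oddAtTop (𝓝 1) := by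
  have hharm : ∀ n : ℕ, ∑ k ∈ Finset.Icc 1 n, 1 / (k : ℝ) = (harmonic n : ℝ) := by
    intro n
    rw [harmonic_eq_sum_Icc]
    push_cast
    simp only [one_div]
  have hb : ∀ᶠ L : ℕ in oddAtTop,
      1 - log 2 / log L ≤ (∑ k ∈ Finset.Icc 1 ((L - 1) / 2), 1 / (k : ℝ)) / log L ∧
      (∑ k ∈ Finset.Icc 1 ((L - 1) / 2), 1 / (k : ℝ)) / log L ≤ 1 + 1 / log L := by
    filter_upwards [eventually_odd_oddAtTop, eventually_ge_oddAtTop 3] with L hL hL3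
    obtain ⟨m, rfl⟩ := hL
    have hm : 1 ≤ m := by omega
    have hm0 : (0 : ℝ) < m := by exact_mod_cast hm
    have hlog : 0 < log ((2 * m + 1 : ℕ) : ℝ) := by
      apply log_pos
      push_cast
      linarith
    rw [show (2 * m + 1 - 1) / 2 = m by omega, hharm]
    have h1 := log_add_one_le_harmonic m
    have h2 := harmonic_le_one_add_log m
    have h3 : log ((2 * m + 1 : ℕ) : ℝ) - log 2 ≤ log ((m + 1 : ℕ) : ℝ) := by
      rw [← log_div (by positivity) (by norm_num)]
      apply log_le_log (by positivity)
      push_cast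
      linarith
    have h4 : log (m : ℝ) ≤ log ((2 * m + 1 : ℕ) : ℝ) := by
      apply log_le_log hm0
      push_cast
      linarith
    constructor
    · rw [le_div_iff₀ hlog, sub_mul, div_mul_cancel₀ _ hlog.ne', one_mul]
      exact h3.trans h1
    · rw [div_le_iff₀ hlog, add_mul, div_mul_cancel₀ _ hlog.ne', one_mul]
      linarith
  have hlo : Tendsto (fun L : ℕ => 1 - log 2 / log (L : ℝ)) oddAtTop (𝓝 1) := by
    simpa using (tendsto_log_oddAtTop.const_div_atTop (log 2)).const_sub 1
  have hhi : Tendsto (fun L : ℕ => 1 + 1 / log (L : ℝ)) oddAtTop (𝓝 1) := by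
    simpa using (tendsto_log_oddAtTop.const_div_atTop 1).const_add 1
  exact tendsto_of_tendsto_of_tendsto_of_le_of_le' hlo hhi (hb.mono fun _ h => h.1)
    (hb.mono fun _ h => h.2)

theorem tendsto_eCoeff_div_log :
    Tendsto (fun L : ℕ => eCoeff L / log L) oddAtTop (𝓝 (1 / (4 * √2))) := by
  have hs := tendsto_sqrt_one_sub_inv_sq
  have h1 : Tendsto (fun L : ℕ => 1 / (4 * √2) * (1 + 1 / (L : ℝ)) ^ 2 /
      √(1 - 1 / (L : ℝ) ^ 2)) oddAtTop (𝓝 (1 / (4 * √2) * (1 + 0) ^ 2 / 1)) :=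
    (((tendsto_inv_oddAtTop.const_add 1).pow 2).const_mul _).div hs one_ne_zero
  have h2 : Tendsto (fun L : ℕ => π ^ 2 / (12 * √2) * √(1 - 1 / (L : ℝ) ^ 2)) oddAtTop
      (𝓝 (π ^ 2 / (12 * √2) * 1)) := hs.const_mul _
  have h3 := (hs.const_mul (1 / (4 * √2))).mul tendsto_harmonic_div_log
  have h4 := ((h1.sub h2).div_atTop tendsto_log_oddAtTop).add h3
  rw [mul_one, mul_one, zero_add] at h4
  refine h4.congr fun L => ?_
  rw [eCoeff]
  ring

/-! ### Assembly of the theorem -/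

theorem mainTheorem5 :
    -- the energy and the solution of the leading-order equation exist and are unique
    (∀ L : ℕ, Odd L → ∀ lam : ℝ, 0 ≤ lam → ∃! Del : ℝ, IsHighestEnergy L lam Del) ∧
    (∀ lam : ℝ, 0 ≤ lam → ∃! u : ℝ, IsLeadingSolution lam u) ∧
    ∀ (Del : ℕ → ℝ → ℝ) (u : ℝ → ℝ),
      (∀ L : ℕ, Odd L → ∀ lam : ℝ, 0 ≤ lam → IsHighestEnergy L lam (Del L lam)) →
      (∀ lam : ℝ, 0 ≤ lam → IsLeadingSolution lam (u lam)) →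
      -- the `1/L` expansion at fixed coupling
      (∀ lam : ℝ, 0 ≤ lam → ∃ z : ℕ → ℝ,
        z 0 = u lam - 1 / 2 ∧ z 1 = 0 ∧ z 2 = zTwo lam (u lam) ∧
        HasInvLExpansion (fun L => Del L lam) z) ∧
      (∀ lam : ℝ, 0 ≤ lam →
        Tendsto (fun L : ℕ => Del L lam / L) oddAtTop (𝓝 (u lam - 1 / 2))) ∧
      -- strong coupling expansion of its coefficients
      ((fun lam : ℝ => u lam - 1 / 2 - (1 / √2 * lam ^ (1 / 4 : ℝ)
          + 1 / (48 * √2) * lam ^ (-1 / 4 : ℝ)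
            * (3 * log lam + 18 * log 2 + 18 - 4 * π ^ 2)))
        =O[atTop] (fun lam : ℝ => lam ^ (-1 / 2 : ℝ) * log lam)) ∧
      ((fun lam : ℝ => zTwo lam (u lam) - (-(1 / (6 * √2)) * lam ^ (1 / 4 : ℝ)))
        =O[atTop] (fun lam : ℝ => lam ^ (-1 / 4 : ℝ) * log lam)) ∧
      -- strong coupling expansion at fixed `L`
      (∀ L : ℕ, Odd L → 3 ≤ L →
        (fun lam : ℝ => Del L lam / L - (cCoeff L * lam ^ (1 / 4 : ℝ) + 1 / (2 * (L : ℝ))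
            + eCoeff L * lam ^ (-1 / 4 : ℝ)))
          =O[atTop] (fun lam : ℝ => lam ^ (-1 / 2 : ℝ))) ∧
      -- at leading order the two limits commute
      (LimLThenLam (fun L lam => Del L lam / (L * lam ^ (1 / 4 : ℝ))) (1 / √2) ∧
        LimLamThenL (fun L lam => Del L lam / (L * lam ^ (1 / 4 : ℝ))) (1 / √2)) ∧
      -- beyond the leading term they do not
      (LimLThenLam (fun L lam => Del L lam / L - 1 / √2 * lam ^ (1 / 4 : ℝ)) 0 ∧
        ∀ L : ℕ, Odd L → 3 ≤ L →
          Tendsto (fun lam => Del L lam / L - 1 / √2 * lam ^ (1 / 4 : ℝ)) atTop atBot) ∧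
      -- the coefficients of `L⁻¹ λ⁰` in the two orders differ
      (LimLThenLam (fun L lam => L * (Del L lam / L - (u lam - 1 / 2))) 0 ∧
        LimLamThenL (fun L lam => L * (Del L lam / L - cCoeff L * lam ^ (1 / 4 : ℝ))) (1 / 2)) ∧
      -- the coefficients of `L⁻² λ^{1/4}` in the two orders differ
      (LimLThenLam (fun L lam =>
          (L : ℝ) ^ 2 * (Del L lam / L - (u lam - 1 / 2)) / lam ^ (1 / 4 : ℝ)) (-(1 / (6 * √2))) ∧
        LimLamThenL (fun L lam =>
          (L : ℝ) ^ 2 * (Del L lam / (L * lam ^ (1 / 4 : ℝ)) - 1 / √2)) (-(1 / (2 * √2)))) ∧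
      -- the fixed-`L` coefficient of `λ^{-1/4}` diverges logarithmically as `L → ∞`
      Tendsto (fun L : ℕ => eCoeff L / log L) oddAtTop (𝓝 (1 / (4 * √2))) := by
  refine ⟨fun L hL lam hlam => existsUnique_isHighestEnergy hL hlam,
    fun lam hlam => existsUnique_isLeadingSolution hlam, fun Del u hDel hu => ?_⟩
  have hD : ∀ {lam : ℝ}, 0 ≤ lam → ∀ L, Odd L → IsHighestEnergy L lam (Del L lam) :=
    fun hlam L hL => hDel L hL _ hlam
  have hlim : ∀ lam : ℝ, 0 ≤ lam →
      Tendsto (fun L : ℕ => Del L lam / L) oddAtTop (𝓝 (u lam - 1 / 2)) := by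
    intro lam hlam
    refine ((tendsto_scaled_energy hlam (hu lam hlam) (hD hlam)).sub_const (1 / 2)).congr
      fun L => ?_
    ring
  have hsq : ∀ lam : ℝ, 0 ≤ lam → Tendsto (fun L : ℕ => (L : ℝ) ^ 2 *
      (Del L lam / L - (u lam - 1 / 2))) oddAtTop (𝓝 (zTwo lam (u lam))) := by
    intro lam hlam
    refine (tendsto_sq_mul_sub hlam (hu lam hlam) (hD hlam)).congr fun L => ?_
    ring
  refine ⟨fun lam hlam => exists_hasInvLExpansion hlam (hu lam hlam) (hD hlam), hlim,
    isBigO_leading_strongCoupling hu, isBigO_zTwo_strongCoupling hu,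
    fun L hL hL3 => isBigO_fixedLength hL hL3 (hDel L hL), ⟨?_, ?_⟩, ⟨?_, ?_⟩, ⟨?_, ?_⟩,
    ⟨?_, ?_⟩, tendsto_eCoeff_div_log⟩
  · refine ⟨fun lam => (u lam - 1 / 2) / lam ^ (1 / 4 : ℝ), fun lam hlam => ?_,
      tendsto_div_fourthRoot (tendsto_leading_sub hu)⟩
    refine ((hlim lam hlam.le).div_const _).congr fun L => ?_
    rw [div_div]
  · refine ⟨cCoeff, fun L hL hL3 => ?_, tendsto_cCoeff⟩
    refine (tendsto_div_fourthRoot (tendsto_fixedLength hL hL3 (hDel L hL))).congr fun lam => ?_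
    rw [div_div]
  · exact ⟨fun lam => u lam - 1 / 2 - 1 / √2 * lam ^ (1 / 4 : ℝ),
      fun lam hlam => (hlim lam hlam.le).sub_const _, tendsto_leading_sub hu⟩
  · exact fun L hL hL3 => tendsto_fixedLength_atBot hL hL3 (hDel L hL)
  -- The inner limit vanishes at every coupling, because the quantity is `1 / L` times one that
  -- converges to `zTwo`.
  · refine ⟨fun _ => 0, fun lam hlam => ?_, tendsto_const_nhds⟩
    have h := (hsq lam hlam.le).mul tendsto_inv_oddAtTop
    rw [mul_zero] at h
    refine h.congr' ?_
    filter_upwards [eventually_ge_oddAtTop 1] with L hL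
    have : (L : ℝ) ≠ 0 := by positivity
    field_simp
  · refine ⟨fun _ => 1 / 2, fun L hL hL3 => ?_, tendsto_const_nhds⟩
    have h := (tendsto_fixedLength hL hL3 (hDel L hL)).const_mul (L : ℝ)
    have hL0 : (L : ℝ) ≠ 0 := by positivity
    have he : (L : ℝ) * (1 / (2 * (L : ℝ))) = 1 / 2 := by field_simp
    rwa [he] at h
  · exact ⟨fun lam => zTwo lam (u lam) / lam ^ (1 / 4 : ℝ),
      fun lam hlam => (hsq lam hlam.le).div_const _, tendsto_div_fourthRoot (tendsto_zTwo_sub hu)⟩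
  · refine ⟨fun L => (L : ℝ) ^ 2 * (cCoeff L - 1 / √2), fun L hL hL3 => ?_,
      tendsto_sq_mul_cCoeff_sub⟩
    have h := ((tendsto_div_fourthRoot (tendsto_fixedLength hL hL3 (hDel L hL))).sub_const
      (1 / √2)).const_mul ((L : ℝ) ^ 2)
    refine h.congr fun lam => ?_
    rw [div_div]
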